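/- For real $\alpha$ let $\lambda_\alpha$ be the first (smallest) eigenvalue of the operator $P_\alpha=-\partial_x^2+(\alpha x)^2$ on $L^2(-1,1)$ with Dirichlet boundary conditions, i.e. with domain $H^1_0(-1,1)\cap H^2(-1,1)$. For a nondecreasing function $r:(0,\pi/2)\to[0,\infty)$ and $\theta\in(0,\pi/2)$ let $$U_{\theta,r(\theta)}=\{z\in\mathbb C:\ |z|>r(\theta),\ |\arg z|<\theta\},$$ let $r(0):=\lim_{\theta\to0^+}r(\theta)=\inf_{0<\theta<\pi/2}r(\theta)$, and let $S(r)$ be the set of functions $\gamma:\bigcup_{0<\theta<\pi/2}U_{\theta,r(\theta)}\to\mathbb C$ that are holomorphic and satisfy $$\sup_{z\in U_{\theta,r(\theta)}}|\gamma(z)|\,e^{-\varepsilon|z|}<\infty\qquad\text{for all }\theta\in(0,\pi/2)\text{ and all }\varepsilon>0 .$$ **Theorem.** There exist a nondecreasing function $r:(0,\pi/2)\to[0,\infty)$ and a function $\gamma\in S(r)$ such that $$\lambda_\alpha=\alpha+\gamma(\alpha)e^{-\alpha}\qquad\text{for all real }\alpha>r(0),$$ and moreover, for every $\theta\in(0,\pi/2)$,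 $$\gamma(\alpha)\sim 4\pi^{-1/2}\alpha^{3/2}\qquad\text{as }|\alpha|\to\infty,\ \alpha\in U_{\theta,r(\theta)},$$ where $\alpha^{3/2}$ is the principal branch. -/

import Mathlib

open MeasureTheory Set Filter Topology Asymptotics
open scoped NNReal ENNReal ContDiff

noncomputable section

namespace GrushinSymbol

/-! ## The operator on the interval with Dirichlet boundary conditions -/

/-- The interval `(-1, 1)`. -/
abbrev interval : Set ℝ := Ioo (-1) 1

/-- The space `L²(-1, 1)` of real-valued functions. -/
abbrev L2 : Type := Lp ℝ 2 (volume.restrict interval)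

/-- Test functions: smooth functions whose support is a compact subset of `(-1, 1)`. -/
structure IsTestFunction (φ : ℝ → ℝ) : Prop where
  contDiff : ContDiff ℝ ∞ φ
  hasCompactSupport : HasCompactSupport φ
  tsupport_subset : tsupport φ ⊆ interval

/-- `v` is the weak derivative of `u` on `(-1, 1)`. -/
def HasWeakDeriv (u v : L2) : Prop :=
  ∀ φ : ℝ → ℝ, IsTestFunction φ →
    ∫ x in interval, u x * deriv φ x = -∫ x in interval, v x * φ x

/-- The pairs `(φ, φ')` in `L² × L²`, for `φ` a test function. -/
def testGraph : Set (L2 × L2) :=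
  {p | ∃ φ : ℝ → ℝ, IsTestFunction φ ∧
    p.1 =ᵐ[volume.restrict interval] φ ∧ p.2 =ᵐ[volume.restrict interval] deriv φ}

/-- The Sobolev space `H¹₀(-1, 1)`: the closure of the test functions for the `H¹` norm, that is
the set of the limits in `L²` of sequences of test functions whose derivatives also converge
in `L²`. -/
def H10 : Set L2 := {u | ∃ v : L2, (u, v) ∈ closure testGraph}

/-- The operator `P_α = -∂ₓ² + (α x)²` on `L²(-1, 1)` with domain `H¹₀(-1, 1) ∩ H²(-1, 1)`, given
by its graph: `u` belongs to the domain and `P_α u = f`. Membership in `H²` is the existence of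
weak derivatives `u'` and `u''` in `L²`. -/
def DirichletOp (α : ℝ) (u f : L2) : Prop :=
  u ∈ H10 ∧ ∃ u' u'' : L2, HasWeakDeriv u u' ∧ HasWeakDeriv u' u'' ∧
    f =ᵐ[volume.restrict interval] fun x => -u'' x + (α * x) ^ 2 * u x

/-- The set of the eigenvalues of `P_α`. -/
def eigenvalues (α : ℝ) : Set ℝ := {μ | ∃ u : L2, u ≠ 0 ∧ DirichletOp α u (μ • u)}

/-- `μ` is the first (smallest) eigenvalue of `P_α`. -/
def IsFirstEigenvalue (α μ : ℝ) : Prop := IsLeast (eigenvalues α) μ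

/-! ## Symbols -/

/-- The truncated sector `U_{θ,R} = {|z| > R, |arg z| < θ}`. -/
def sector (θ R : ℝ) : Set ℂ := {z | R < ‖z‖ ∧ |z.arg| < θ}

/-- The union of the `U_{θ,r(θ)}` for `0 < θ < π/2`. -/
def symbolDomain (r : Ioo (0 : ℝ) (Real.pi / 2) → ℝ≥0) : Set ℂ :=
  ⋃ θ : Ioo (0 : ℝ) (Real.pi / 2), sector θ (r θ)

/-- The space `S(r)`: the functions that are holomorphic on the union of the `U_{θ,r(θ)}` and have
sub-exponential growth on each of them. Only the values on that union are constrained. -/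
def symbolSpace (r : Ioo (0 : ℝ) (Real.pi / 2) → ℝ≥0) : Set (ℂ → ℂ) :=
  {γ | DifferentiableOn ℂ γ (symbolDomain r) ∧
    ∀ θ : Ioo (0 : ℝ) (Real.pi / 2), ∀ ε : ℝ, 0 < ε →
      BddAbove ((fun z : ℂ => ‖γ z‖ * Real.exp (-ε * ‖z‖)) '' sector θ (r θ))}

/-- The value `r(0)` of a nondecreasing function `r` on `(0, π/2)`: its limit at `0` from the
right, that is its infimum. A real number `α` lies in `symbolDomain r` exactly when it is
greater than `r(0)`. -/
def rZero (r : Ioo (0 : ℝ) (Real.pi / 2) → ℝ≥0) : ℝ :=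
  ⨅ θ : Ioo (0 : ℝ) (Real.pi / 2), (r θ : ℝ)

end GrushinSymbol

end

/-! ## The Kummer series -/

namespace GrushinSymbol

/-! The even solution of `-V'' + (α x)² V = (α - 4αa) V` is `e^(-αx²/2) M(a, 1/2, αx²)`, with `M`
Kummer's function. The Dirichlet condition at `±1` is therefore `M(a, 1/2, α) = 0`, and the theorem
describes the root `a` near `0`, where the eigenvalue is close to `α`. Writing `M(a, 1/2, z) = 1 + a
K(a, z)` with `K = kummer`, the condition becomes the fixed point equation `a = -1 / K(a, z)`, which
makes sense for complex `z`.

Two facts on `K` make this equation solvable. At `a = 0`, a Laplace-type integral gives `K(0, z) ∼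
√π e^z z^(-1/2)` in every cone `c|z| ≤ Re z`, `c > 0` (`tendsto_kummer_zero`). For small `a`,
Euler's integral bounds `K(a, z)` by a multiple of `|z| e^(Re z)` uniformly in `a`, and Cauchy's
estimate turns this into a Lipschitz bound in `a` (`exists_kummer_lipschitz`). The Lipschitz
constant is negligible against `|K(0, z)|²`, so `a ↦ -1 / K(a, z)` contracts the disc of radius `2 /
|K(0, z)|` for large `z` in the cone. The iterates from `0` are holomorphic in `z` and converge
uniformly; their limit `root` is holomorphic and `root z ∼ -1 / K(0, z)`. Hence `γ(z) = -4 z e^z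
root z ∼ 4 π^(-1/2) z^(3/2)`.

For real `α` the root is real by uniqueness, and negative. Since `K(a, ·)` increases on `[0, ∞)`,
`M(a, 1/2, αx²)` decreases in `x²` and vanishes exactly at `x = ±1`: the eigenfunction is positive
on `(-1, 1)`. A positive solution gives the smallest eigenvalue by Jacobi's identity, which writes
the quadratic form of `P_α - λ` on test functions as the integral of a square; the inequality passes
to `H¹₀` by closure (`IsGroundState.isFirstEigenvalue`). -/

/-- The coefficient of `z ^ (n + 1)` in `(M(a, 1/2, z) - 1) / a`. -/
noncomputable def kummerCoeff (n : ℕ) (a : ℂ) : ℂ :=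
  (∏ j ∈ Finset.range n, (a + 1 + j)) /
    ((∏ j ∈ Finset.range (n + 1), ((j : ℂ) + 1 / 2)) * (n + 1).factorial)

/-- The function `(M(a, 1/2, z) - 1) / a`, where `M` is Kummer's confluent hypergeometric function. -/
noncomputable def kummer (a z : ℂ) : ℂ := ∑' n : ℕ, kummerCoeff n a * z ^ (n + 1)

lemma prod_half_ofReal (n : ℕ) :
    ∏ j ∈ Finset.range (n + 1), ((j : ℂ) + 1 / 2) =
      ((∏ j ∈ Finset.range (n + 1), ((j : ℝ) + 1 / 2) : ℝ) : ℂ) := by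
  push_cast; rfl

lemma factorial_half_le_prod (n : ℕ) :
    (n.factorial : ℝ) / 2 ≤ ∏ j ∈ Finset.range (n + 1), ((j : ℝ) + 1 / 2) := by
  induction n with
  | zero => simp
  | succ n ih =>
    rw [Finset.prod_range_succ, Nat.factorial_succ]
    push_cast
    have : (0 : ℝ) ≤ n.factorial := by positivity
    nlinarith

lemma norm_prod_le_factorial (n : ℕ) {a : ℂ} (ha : ‖a‖ ≤ 1) :
    ‖∏ j ∈ Finset.range n, (a + 1 + j)‖ ≤ (n + 1).factorial := by
  induction n with
  | zero => simp
  | succ n ih =>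
    rw [Finset.prod_range_succ, norm_mul, Nat.factorial_succ (n + 1), mul_comm]
    push_cast
    have h : ‖a + 1 + n‖ ≤ n + 1 + 1 := by
      calc ‖a + 1 + n‖ ≤ ‖a‖ + ‖(1 : ℂ)‖ + ‖(n : ℂ)‖ := norm_add₃_le
        _ ≤ n + 1 + 1 := by simp; linarith
    gcongr

/-- The factorial `(n + 1)!` in the denominator cancels the bound on the numerator, and
`(1/2)(3/2)⋯(n + 1/2) ≥ n!/2` remains. Every convergence statement on the series rests on this
majorant, uniform in `a`. -/
lemma norm_kummerCoeff_le (n : ℕ) {a : ℂ} (ha : ‖a‖ ≤ 1) :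
    ‖kummerCoeff n a‖ ≤ 2 / n.factorial := by
  have h1 := norm_prod_le_factorial n ha
  have h2 := factorial_half_le_prod n
  have h3 : (0 : ℝ) < n.factorial := by positivity
  have h4 : (0 : ℝ) < (n + 1).factorial := by positivity
  have h5 : (0 : ℝ) < ∏ j ∈ Finset.range (n + 1), ((j : ℝ) + 1 / 2) := by positivity
  rw [kummerCoeff, prod_half_ofReal, norm_div, norm_mul, Complex.norm_real, Complex.norm_natCast,
    Real.norm_of_nonneg h5.le, div_le_div_iff₀ (by positivity) h3]
  nlinarith [mul_le_mul h1 h2 (by positivity) h4.le]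

lemma summable_pow_succ_div_factorial (R : ℝ) :
    Summable fun n : ℕ => 2 / (n.factorial : ℝ) * R ^ (n + 1) := by
  refine ((Real.summable_pow_div_factorial R).mul_left (2 * R)).congr fun n => ?_
  rw [pow_succ]; ring

lemma norm_kummer_term_le (n : ℕ) {a z : ℂ} {R : ℝ} (ha : ‖a‖ ≤ 1) (hz : ‖z‖ ≤ R) :
    ‖kummerCoeff n a * z ^ (n + 1)‖ ≤ 2 / n.factorial * R ^ (n + 1) := by
  rw [norm_mul, norm_pow]
  gcongr
  exact norm_kummerCoeff_le n ha

lemma hasSum_kummer {a : ℂ} (ha : ‖a‖ ≤ 1) (z : ℂ) :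
    HasSum (fun n : ℕ => kummerCoeff n a * z ^ (n + 1)) (kummer a z) :=
  (Summable.of_norm_bounded (summable_pow_succ_div_factorial ‖z‖)
    fun n => norm_kummer_term_le n ha le_rfl).hasSum

lemma differentiable_kummerCoeff (n : ℕ) : Differentiable ℂ (kummerCoeff n) := by
  unfold kummerCoeff
  fun_prop

/-- Substituting holomorphic functions in both arguments at once keeps the argument in one variable:
the series converges uniformly wherever `h` is bounded. This is the form needed for the fixed point
iterates. -/
lemma differentiableOn_kummer_comp {g h : ℂ → ℂ} {U : Set ℂ} (hU : IsOpen U)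
    (hg : DifferentiableOn ℂ g U) (hh : DifferentiableOn ℂ h U) (hg1 : ∀ z ∈ U, ‖g z‖ ≤ 1) :
    DifferentiableOn ℂ (fun z => kummer (g z) (h z)) U := by
  intro z hz
  have hV : IsOpen (U ∩ {w | ‖h w‖ < ‖h z‖ + 1}) :=
    hh.continuousOn.norm.isOpen_inter_preimage hU isOpen_Iio
  refine ((Complex.differentiableOn_tsum_of_summable_norm
    (summable_pow_succ_div_factorial (‖h z‖ + 1)) (fun n => ?_) hV ?_).differentiableAt
    (hV.mem_nhds ⟨hz, ?_⟩)).differentiableWithinAt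
  · have h1 : DifferentiableOn ℂ (fun w => kummerCoeff n (g w)) U :=
      (differentiable_kummerCoeff n).comp_differentiableOn hg
    exact (h1.mul (hh.pow _)).mono inter_subset_left
  · exact fun n w hw => norm_kummer_term_le n (hg1 w hw.1) (le_of_lt hw.2)
  · simp

lemma differentiable_kummer {a : ℂ} (ha : ‖a‖ ≤ 1) : Differentiable ℂ (kummer a) := by
  rw [← differentiableOn_univ]
  exact differentiableOn_kummer_comp isOpen_univ (differentiableOn_const a) differentiableOn_id
    fun _ _ => ha

lemma differentiableOn_kummer_param (z : ℂ) :
    DifferentiableOn ℂ (fun a => kummer a z) (Metric.ball 0 1) :=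
  differentiableOn_kummer_comp Metric.isOpen_ball differentiableOn_id (differentiableOn_const z)
    fun _ h => (mem_ball_zero_iff.1 h).le

lemma hasSum_deriv_kummer {a : ℂ} (ha : ‖a‖ ≤ 1) (z : ℂ) :
    HasSum (fun n : ℕ => kummerCoeff n a * ((n + 1) * z ^ n)) (deriv (kummer a) z) := by
  have h := Complex.hasSum_deriv_of_summable_norm (F := fun n w => kummerCoeff n a * w ^ (n + 1))
    (summable_pow_succ_div_factorial (‖z‖ + 1)) (fun n => by fun_prop)
    (Metric.isOpen_ball (x := (0 : ℂ)) (ε := ‖z‖ + 1))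
    (fun n w hw => norm_kummer_term_le n ha (mem_ball_zero_iff.1 hw).le)
    (mem_ball_zero_iff.2 (lt_add_one ‖z‖))
  refine h.congr_fun fun n => ?_
  simp

lemma summable_succ_mul_pow_div_factorial (R : ℝ) :
    Summable fun n : ℕ => 2 / (n.factorial : ℝ) * ((n + 1) * R ^ n) := by
  rw [← summable_nat_add_iff 1]
  refine (((Real.summable_pow_div_factorial R).mul_left (2 * R)).add
    ((summable_nat_add_iff 1).2 ((Real.summable_pow_div_factorial R).mul_left 2))).congr fun n => ?_
  rw [Nat.factorial_succ, pow_succ]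
  push_cast
  field_simp

lemma hasSum_deriv_deriv_kummer {a : ℂ} (ha : ‖a‖ ≤ 1) (z : ℂ) :
    HasSum (fun n : ℕ => kummerCoeff n a * ((n + 1) * (n * z ^ (n - 1))))
      (deriv (deriv (kummer a)) z) := by
  have hd : deriv (kummer a) = fun w => ∑' n : ℕ, kummerCoeff n a * ((n + 1) * w ^ n) :=
    funext fun w => (hasSum_deriv_kummer ha w).tsum_eq.symm
  rw [hd]
  have h := Complex.hasSum_deriv_of_summable_norm
    (F := fun (n : ℕ) (w : ℂ) => kummerCoeff n a * ((n + 1) * w ^ n))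
    (summable_succ_mul_pow_div_factorial (‖z‖ + 1)) (fun n => by fun_prop)
    (Metric.isOpen_ball (x := (0 : ℂ)) (ε := ‖z‖ + 1))
    (fun n w hw => by
      have hn : ‖(n : ℂ) + 1‖ = n + 1 := by
        rw [← Nat.cast_add_one, Complex.norm_natCast]; simp
      rw [norm_mul, norm_mul, norm_pow, hn]
      gcongr
      · exact norm_kummerCoeff_le n ha
      · exact (mem_ball_zero_iff.1 hw).le)
    (mem_ball_zero_iff.2 (lt_add_one ‖z‖))
  refine h.congr_fun fun n => ?_
  simp

lemma kummerCoeff_zero (a : ℂ) : kummerCoeff 0 a = 2 := by simp [kummerCoeff]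

lemma kummerCoeff_succ (n : ℕ) (a : ℂ) :
    kummerCoeff (n + 1) a * ((n + 2) * (n + 3 / 2)) = kummerCoeff n a * (a + 1 + n) := by
  have h : (∏ j ∈ Finset.range (n + 1), ((j : ℂ) + 1 / 2)) ≠ 0 := by
    rw [prod_half_ofReal]
    exact_mod_cast ne_of_gt (by positivity)
  have h2 : (n : ℂ) + 1 + 1 / 2 ≠ 0 := by
    have : (n : ℂ) + 1 + 1 / 2 = ((n + 1 + 1 / 2 : ℝ) : ℂ) := by push_cast; ring
    rw [this]
    exact_mod_cast ne_of_gt (by positivity)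
  have h3 : ((n + 1).factorial : ℂ) ≠ 0 := by exact_mod_cast Nat.factorial_ne_zero _
  have h4 : (n : ℂ) + 1 + 1 ≠ 0 := by exact_mod_cast Nat.succ_ne_zero (n + 1)
  unfold kummerCoeff
  rw [Finset.prod_range_succ, Finset.prod_range_succ _ (n + 1), Nat.factorial_succ (n + 1)]
  push_cast
  generalize (∏ j ∈ Finset.range (n + 1), ((j : ℂ) + 1 / 2)) = P at *
  generalize (∏ j ∈ Finset.range n, (a + 1 + (j : ℂ))) = Q at *
  rw [div_mul_eq_mul_div, div_mul_eq_mul_div, div_eq_div_iff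
    (mul_ne_zero (mul_ne_zero h h2) (mul_ne_zero h4 h3)) (mul_ne_zero h h3)]
  ring

/-- Kummer's equation. -/
lemma kummer_ode {a : ℂ} (ha : ‖a‖ ≤ 1) (z : ℂ) :
    z * deriv (deriv (kummer a)) z + (1 / 2 - z) * deriv (kummer a) z = 1 + a * kummer a z := by
  have h0 := hasSum_kummer ha z
  have h1 := hasSum_deriv_kummer ha z
  have h2 := hasSum_deriv_deriv_kummer ha z
  have h3 := ((h2.mul_left z).add (h1.mul_left (1 / 2)))
  -- The term `n = 0` of the left side is half the leading coefficient `2`, which is the constant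
  -- `1` of the equation; the other terms match through the recurrence of the coefficients.
  rw [← hasSum_nat_add_iff' 1] at h3
  have h4 := (h1.mul_left z).add (h0.mul_left a)
  have h5 := h3.unique (h4.congr_fun fun n => ?_)
  · simp [kummerCoeff_zero] at h5
    linear_combination h5
  · have := kummerCoeff_succ n a
    push_cast
    rw [pow_succ z n]
    linear_combination z ^ n * z * this

/-- The coefficients at a real parameter. -/
lemma kummerCoeff_ofReal_pos (n : ℕ) {a : ℝ} (ha : -1 < a) :
    ∃ c : ℝ, 0 < c ∧ kummerCoeff n a = c := by
  refine ⟨(∏ j ∈ Finset.range n, (a + 1 + j)) /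
    ((∏ j ∈ Finset.range (n + 1), ((j : ℝ) + 1 / 2)) * (n + 1).factorial), ?_, ?_⟩
  · have : 0 < ∏ j ∈ Finset.range n, (a + 1 + (j : ℝ)) :=
      Finset.prod_pos fun j _ => by have : (0 : ℝ) ≤ j := j.cast_nonneg; linarith
    positivity
  · simp [kummerCoeff]

lemma kummer_conj (a z : ℂ) :
    kummer ((starRingEnd ℂ) a) ((starRingEnd ℂ) z) = (starRingEnd ℂ) (kummer a z) := by
  unfold kummer
  rw [Complex.conj_tsum]
  refine tsum_congr fun n => ?_
  simp [kummerCoeff, map_prod, map_ofNat]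

lemma kummer_ofReal {a : ℝ} (t : ℝ) : kummer a t = ((kummer a t).re : ℂ) := by
  have := kummer_conj a t
  rw [Complex.conj_ofReal, Complex.conj_ofReal] at this
  exact (Complex.conj_eq_iff_re.1 this.symm).symm

/-- `kummer a` is strictly increasing on `[0, ∞)` for real `a > -1`. -/
lemma kummer_re_lt {a : ℝ} (ha : -1 < a) (ha1 : a ≤ 1) {s t : ℝ} (hs : 0 ≤ s) (hst : s < t) :
    (kummer a s).re < (kummer a t).re := by
  have hn : ‖(a : ℂ)‖ ≤ 1 := by
    rw [Complex.norm_real, Real.norm_eq_abs, abs_le]; exact ⟨ha.le, ha1⟩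
  have h1 := Complex.hasSum_re (hasSum_kummer hn s)
  have h2 := Complex.hasSum_re (hasSum_kummer hn t)
  have key : ∀ n (r : ℝ), ∃ c : ℝ, 0 < c ∧ ∀ r : ℝ,
      (kummerCoeff n a * (r : ℂ) ^ (n + 1)).re = c * r ^ (n + 1) := fun n r => by
    obtain ⟨c, hc, h⟩ := kummerCoeff_ofReal_pos n ha
    refine ⟨c, hc, fun r => ?_⟩
    rw [h, ← Complex.ofReal_pow, ← Complex.ofReal_mul, Complex.ofReal_re]
  refine hasSum_lt (i := 0) (fun n => ?_) ?_ h1 h2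
  · obtain ⟨c, hc, h⟩ := key n 0
    rw [h, h]
    gcongr
  · obtain ⟨c, hc, h⟩ := key 0 0
    rw [h, h]
    gcongr

lemma kummer_zero_right (a : ℂ) : kummer a 0 = 0 := by simp [kummer]

end GrushinSymbol

/-! ## The integral representation and its consequences -/

namespace GrushinSymbol

/-- The mean value inequality on the right half-plane, where the derivative of `e^(-w)` has modulus
at most `1`. -/
lemma norm_exp_neg_sub_one_le {v : ℂ} (hv : 0 ≤ v.re) : ‖Complex.exp (-v) - 1‖ ≤ ‖v‖ := by
  have hs : Convex ℝ {w : ℂ | 0 ≤ w.re} := convex_halfSpace_re_ge 0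
  have h := hs.norm_image_sub_le_of_norm_deriv_le (𝕜 := ℂ) (f := fun w : ℂ => Complex.exp (-w))
    (C := 1) (x := 0) (y := v) (fun w _ => by fun_prop) (fun w hw => ?_) (by simp) hv
  · simpa using h
  · have hd : HasDerivAt (fun w : ℂ => Complex.exp (-w)) (Complex.exp (-w) * -1) w :=
      (hasDerivAt_neg w).cexp
    rw [hd.deriv]
    simpa [Complex.norm_exp] using hw

lemma norm_exp_sub_one_le_mul_exp {w : ℂ} (hw : 0 ≤ w.re) :
    ‖Complex.exp w - 1‖ ≤ ‖w‖ * Real.exp w.re := by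
  have h : Complex.exp w - 1 = -(Complex.exp w * (Complex.exp (-w) - 1)) := by
    rw [mul_sub, ← Complex.exp_add]; simp
  rw [h, norm_neg, norm_mul, Complex.norm_exp, mul_comm]
  gcongr
  exact norm_exp_neg_sub_one_le hw

/-- The weight `t ^ a * (1 - t) ^ (-1/2 - a)`. -/
noncomputable def betaWeight (a : ℂ) (t : ℝ) : ℂ :=
  (t : ℂ) ^ (a + 1 - 1) * (1 - (t : ℂ)) ^ (1 / 2 - a - 1)

/-- The normalizing factor of the integral representation. -/
noncomputable def betaFactor (a : ℂ) : ℂ :=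
  Complex.Gamma (1 / 2) * ((Complex.Gamma (1 / 2 - a))⁻¹ * (Complex.Gamma (a + 1))⁻¹)

lemma abs_re_le_quarter {a : ℂ} (ha : ‖a‖ ≤ 1 / 4) : -(1 / 4) ≤ a.re ∧ a.re ≤ 1 / 4 :=
  abs_le.1 ((Complex.abs_re_le_norm a).trans ha)

lemma integrableOn_betaWeight {a : ℂ} (ha : ‖a‖ ≤ 1 / 4) :
    IntegrableOn (betaWeight a) (Ioc 0 1) := by
  obtain ⟨h1, h2⟩ := abs_re_le_quarter ha
  have := Complex.betaIntegral_convergent (u := a + 1) (v := 1 / 2 - a)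
    (by simp; linarith) (by simp; linarith)
  rwa [intervalIntegrable_iff_integrableOn_Ioc_of_le zero_le_one] at this

lemma Gamma_add_one_add_nat {a : ℂ} (ha : 0 < (a + 1).re) (n : ℕ) :
    Complex.Gamma (a + 1 + n) =
      Complex.Gamma (a + 1) * ∏ j ∈ Finset.range n, (a + 1 + j) := by
  induction n with
  | zero => simp
  | succ n ih =>
    have h0 : a + 1 + n ≠ 0 := fun h => by
      have := congrArg Complex.re h
      simp at this ha
      have : (0 : ℝ) ≤ n := n.cast_nonneg
      linarith
    rw [Finset.prod_range_succ, Nat.cast_succ, ← add_assoc, Complex.Gamma_add_one _ h0, ih]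
    ring

/-- Both Pochhammer products are quotients of Gamma values, and the identity `Γ(s)Γ(t) = Γ(s +
t)B(s, t)` with `s + t = n + 3/2` combines them. -/
lemma kummerCoeff_eq_betaIntegral {a : ℂ} (ha : ‖a‖ ≤ 1 / 4) (n : ℕ) :
    kummerCoeff n a =
      betaFactor a * (Complex.betaIntegral (a + n + 1) (1 / 2 - a) / (n + 1).factorial) := by
  obtain ⟨h1, h2⟩ := abs_re_le_quarter ha
  have hn : (0 : ℝ) ≤ n := n.cast_nonneg
  have hb := Complex.Gamma_mul_Gamma_eq_betaIntegral (s := a + n + 1) (t := 1 / 2 - a)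
    (by simp; linarith) (by simp; linarith)
  have g1 := Gamma_add_one_add_nat (a := a) (by simp; linarith) n
  -- The value `-1/2` makes the base point `a + 1` equal to `1/2`.
  have g2 := Gamma_add_one_add_nat (a := -1 / 2) (by norm_num) (n + 1)
  have e1 : a + n + 1 = a + 1 + n := by ring
  have e2 : a + n + 1 + (1 / 2 - a) = -1 / 2 + 1 + (n + 1 : ℕ) := by push_cast; ring
  have e3 : (-1 / 2 + 1 : ℂ) = 1 / 2 := by norm_num
  have e4 : ∏ j ∈ Finset.range (n + 1), ((-1 / 2 : ℂ) + 1 + j) =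
      ∏ j ∈ Finset.range (n + 1), ((j : ℂ) + 1 / 2) :=
    Finset.prod_congr rfl fun j _ => by ring
  rw [e2, g2, e4, e3, e1, g1] at hb
  have k1 : Complex.Gamma (1 / 2 - a) ≠ 0 :=
    Complex.Gamma_ne_zero_of_re_pos (by simp; linarith)
  have k2 : Complex.Gamma (a + 1) ≠ 0 :=
    Complex.Gamma_ne_zero_of_re_pos (by simp; linarith)
  have k3 : (∏ j ∈ Finset.range (n + 1), ((j : ℂ) + 1 / 2)) ≠ 0 := by
    rw [prod_half_ofReal]
    exact_mod_cast ne_of_gt (by positivity)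
  have k4 : ((n + 1).factorial : ℂ) ≠ 0 := by exact_mod_cast Nat.factorial_ne_zero _
  rw [kummerCoeff, betaFactor, e1]
  generalize Complex.betaIntegral (a + 1 + n) (1 / 2 - a) = B at *
  generalize (∏ j ∈ Finset.range (n + 1), ((j : ℂ) + 1 / 2)) = P at *
  generalize (∏ j ∈ Finset.range n, (a + 1 + (j : ℂ))) = Q at *
  generalize Complex.Gamma (1 / 2 - a) = G at *
  field_simp
  linear_combination hb

lemma hasSum_exp_sub_one_div {z : ℂ} {t : ℝ} (ht : t ≠ 0) :
    HasSum (fun n : ℕ => z ^ (n + 1) / (n + 1).factorial * (t : ℂ) ^ n)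
      ((Complex.exp (z * t) - 1) / t) := by
  have h := NormedSpace.exp_series_hasSum_exp' (𝕂 := ℂ) (z * t)
  rw [← Complex.exp_eq_exp_ℂ, ← hasSum_nat_add_iff' 1] at h
  have h2 := h.div_const (t : ℂ)
  simp only [Finset.range_one, Finset.sum_singleton, Nat.factorial_zero, Nat.cast_one, inv_one,
    pow_zero, smul_eq_mul, mul_one] at h2
  refine h2.congr_fun fun n => ?_
  have : (t : ℂ) ≠ 0 := by exact_mod_cast ht
  rw [mul_pow, pow_succ (t : ℂ)]
  field_simp

/-- Euler's integral for `M`, with the constant term removed and divided by `a`. Replacing `e^(zt)`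
by `(e^(zt) - 1)/t` weakens the singularity at `t = 0`, so the formula holds in a full neighbourhood
of `a = 0`. -/
lemma kummer_eq_integral {a : ℂ} (ha : ‖a‖ ≤ 1 / 4) (z : ℂ) :
    kummer a z = betaFactor a *
      ∫ t in Ioc (0 : ℝ) 1, betaWeight a t * ((Complex.exp (z * t) - 1) / t) := by
  have hw := integrableOn_betaWeight ha
  set f : ℕ → ℝ → ℂ := fun n t => betaWeight a t * (z ^ (n + 1) / (n + 1).factorial * (t : ℂ) ^ n)
    with hf
  have hle : ∀ n, ∀ t ∈ Ioc (0 : ℝ) 1,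
      ‖f n t‖ ≤ ‖betaWeight a t‖ * (‖z‖ ^ (n + 1) / (n + 1).factorial) := fun n t ht => by
    rw [hf]
    simp only [norm_mul, norm_div, norm_pow, Complex.norm_natCast, Complex.norm_real,
      Real.norm_of_nonneg ht.1.le]
    gcongr
    exact mul_le_of_le_one_right (by positivity) (pow_le_one₀ ht.1.le ht.2)
  have hint : ∀ n, Integrable (f n) (volume.restrict (Ioc 0 1)) := fun n => by
    refine Integrable.mono' (hw.norm.mul_const (‖z‖ ^ (n + 1) / (n + 1).factorial))
      (hw.aestronglyMeasurable.mul (by fun_prop)) ?_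
    filter_upwards [ae_restrict_mem measurableSet_Ioc] with t ht using hle n t ht
  have hsum : Summable fun n => ∫ t in Ioc (0 : ℝ) 1, ‖f n t‖ := by
    refine Summable.of_nonneg_of_le (fun n => by positivity) (fun n => ?_)
      (((summable_nat_add_iff 1).2 (Real.summable_pow_div_factorial ‖z‖)).mul_left
        (∫ t in Ioc (0 : ℝ) 1, ‖betaWeight a t‖))
    rw [← integral_mul_const]
    refine setIntegral_mono_on (hint n).norm (hw.norm.mul_const _) measurableSet_Ioc (hle n)
  have h1 := (hasSum_integral_of_summable_integral_norm hint hsum).mul_left (betaFactor a)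
  have h2 : (∫ t in Ioc (0 : ℝ) 1, ∑' n, f n t) =
      ∫ t in Ioc (0 : ℝ) 1, betaWeight a t * ((Complex.exp (z * t) - 1) / t) :=
    setIntegral_congr_fun measurableSet_Ioc fun t ht =>
      ((hasSum_exp_sub_one_div ht.1.ne').mul_left _).tsum_eq
  rw [h2] at h1
  refine (hasSum_kummer (ha.trans (by norm_num)) z).unique (h1.congr_fun fun n => ?_)
  have h3 : (∫ t in Ioc (0 : ℝ) 1, f n t) =
      z ^ (n + 1) / (n + 1).factorial * Complex.betaIntegral (a + n + 1) (1 / 2 - a) := by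
    rw [Complex.betaIntegral, intervalIntegral.integral_of_le zero_le_one, ← integral_const_mul]
    refine setIntegral_congr_fun measurableSet_Ioc fun t ht => ?_
    have h0 : (t : ℂ) ≠ 0 := by exact_mod_cast ht.1.ne'
    have : (t : ℂ) ^ (a + n + 1 - 1) = (t : ℂ) ^ (a + 1 - 1) * (t : ℂ) ^ n := by
      rw [← Complex.cpow_natCast, ← Complex.cpow_add _ _ h0]
      congr 1
      ring
    simp only [hf, betaWeight, this]
    ring
  rw [h3, kummerCoeff_eq_betaIntegral ha]
  ring

lemma norm_exp_sub_one_div_le {z : ℂ} (hz : 0 ≤ z.re) {t : ℝ} (ht : t ∈ Ioc (0 : ℝ) 1) :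
    ‖(Complex.exp (z * t) - 1) / t‖ ≤ ‖z‖ * Real.exp z.re := by
  have h0 : (z * t).re = z.re * t := by simp
  have h1 := norm_exp_sub_one_le_mul_exp (w := z * t) (by rw [h0]; exact mul_nonneg hz ht.1.le)
  rw [norm_div, Complex.norm_real, Real.norm_of_nonneg ht.1.le, div_le_iff₀ ht.1]
  refine h1.trans ?_
  rw [h0, norm_mul, Complex.norm_real, Real.norm_of_nonneg ht.1.le, mul_right_comm]
  gcongr
  · exact ht.1.le
  · exact mul_le_of_le_one_right hz ht.2

/-- A majorant independent of `a`: for bases in `(0, 1)` the worst exponents allowed by `|Re a| ≤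
1/4` are the smallest ones. -/
lemma norm_betaWeight_le {a : ℂ} (ha : ‖a‖ ≤ 1 / 4) {t : ℝ} (ht : t ∈ Ioo (0 : ℝ) 1) :
    ‖betaWeight a t‖ ≤ t ^ (-(1 / 4) : ℝ) * (1 - t) ^ (-(3 / 4) : ℝ) := by
  obtain ⟨h1, h2⟩ := abs_re_le_quarter ha
  have ht' : 0 < 1 - t := sub_pos.2 ht.2
  rw [betaWeight, norm_mul, Complex.norm_cpow_eq_rpow_re_of_pos ht.1, ← Complex.ofReal_one,
    ← Complex.ofReal_sub, Complex.norm_cpow_eq_rpow_re_of_pos ht']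
  refine mul_le_mul (Real.rpow_le_rpow_of_exponent_ge ht.1 ht.2.le ?_)
    (Real.rpow_le_rpow_of_exponent_ge ht' (by linarith [ht.1]) ?_) (by positivity)
    (Real.rpow_nonneg ht.1.le _)
  · simp; linarith
  · simp; linarith

lemma integrableOn_rpow_mul_rpow :
    IntegrableOn (fun t : ℝ => t ^ (-(1 / 4) : ℝ) * (1 - t) ^ (-(3 / 4) : ℝ)) (Ioo 0 1) := by
  have h := Complex.betaIntegral_convergent (u := 3 / 4) (v := 1 / 4) (by norm_num) (by norm_num)
  rw [intervalIntegrable_iff_integrableOn_Ioo_of_le zero_le_one] at h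
  refine IntegrableOn.congr_fun h.norm (fun t ht => ?_) measurableSet_Ioo
  have ht' : 0 < 1 - t := sub_pos.2 ht.2
  rw [norm_mul, Complex.norm_cpow_eq_rpow_re_of_pos ht.1, ← Complex.ofReal_one,
    ← Complex.ofReal_sub, Complex.norm_cpow_eq_rpow_re_of_pos ht']
  norm_num

lemma continuous_betaFactor : Continuous betaFactor := by
  have h := Complex.differentiable_one_div_Gamma.continuous
  unfold betaFactor
  exact continuous_const.mul ((h.comp (by fun_prop : Continuous fun a : ℂ => 1 / 2 - a)).mul
    (h.comp (by fun_prop : Continuous fun a : ℂ => a + 1)))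

/-- `kummer` is `O(|z| e^{Re z})` on the right half-plane, uniformly for small parameters. -/
lemma exists_norm_kummer_le :
    ∃ C : ℝ, 0 < C ∧ ∀ a : ℂ, ‖a‖ ≤ 1 / 4 → ∀ z : ℂ, 0 ≤ z.re →
      ‖kummer a z‖ ≤ C * (‖z‖ * Real.exp z.re) := by
  obtain ⟨M, hM⟩ := (isCompact_closedBall (0 : ℂ) (1 / 4)).exists_bound_of_continuousOn
    continuous_betaFactor.continuousOn
  set I := ∫ t in Ioo (0 : ℝ) 1, t ^ (-(1 / 4) : ℝ) * (1 - t) ^ (-(3 / 4) : ℝ) with hI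
  have hI0 : 0 ≤ I := setIntegral_nonneg measurableSet_Ioo fun t ht => by
    have ht' : 0 < 1 - t := sub_pos.2 ht.2
    have := ht.1
    positivity
  have hM0 : 0 ≤ M := (norm_nonneg _).trans (hM 0 (by simp))
  refine ⟨M * I + 1, by positivity, fun a ha z hz => ?_⟩
  rw [kummer_eq_integral ha, norm_mul, integral_Ioc_eq_integral_Ioo]
  have h1 : ‖∫ t in Ioo (0 : ℝ) 1, betaWeight a t * ((Complex.exp (z * t) - 1) / t)‖ ≤
      I * (‖z‖ * Real.exp z.re) := by
    rw [hI, ← integral_mul_const]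
    refine norm_integral_le_of_norm_le (integrableOn_rpow_mul_rpow.mul_const _) ?_
    filter_upwards [ae_restrict_mem measurableSet_Ioo] with t ht
    have ht' : 0 < 1 - t := sub_pos.2 ht.2
    have := ht.1
    rw [norm_mul]
    gcongr
    · exact norm_betaWeight_le ha ht
    · exact norm_exp_sub_one_div_le hz (Ioo_subset_Ioc_self ht)
  calc _ ≤ M * (I * (‖z‖ * Real.exp z.re)) :=
        mul_le_mul (hM a (by simpa using ha)) h1 (norm_nonneg _) hM0
    _ ≤ _ := by
        have : 0 ≤ ‖z‖ * Real.exp z.re := by positivity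
        nlinarith

/-- A Lipschitz estimate in the parameter. -/
lemma exists_kummer_lipschitz :
    ∃ C : ℝ, 0 < C ∧ ∀ z : ℂ, 0 ≤ z.re → ∀ a b : ℂ, ‖a‖ ≤ 1 / 8 → ‖b‖ ≤ 1 / 8 →
      ‖kummer a z - kummer b z‖ ≤ C * (‖z‖ * Real.exp z.re) * ‖a - b‖ := by
  obtain ⟨C, hC, h⟩ := exists_norm_kummer_le
  refine ⟨8 * C, by positivity, fun z hz a b ha hb => ?_⟩
  have hd : ∀ c : ℂ, ‖c‖ < 1 → DifferentiableAt ℂ (fun a => kummer a z) c := fun c hc =>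
    (differentiableOn_kummer_param z).differentiableAt
      (Metric.isOpen_ball.mem_nhds (mem_ball_zero_iff.2 hc))
  refine (convex_closedBall (0 : ℂ) (1 / 8)).norm_image_sub_le_of_norm_deriv_le (𝕜 := ℂ)
    (f := fun a => kummer a z) (fun c hc => ?_) (fun c hc => ?_) (by simpa using hb)
    (by simpa using ha)
  · rw [mem_closedBall_zero_iff] at hc
    exact hd c (by linarith)
  · rw [mem_closedBall_zero_iff] at hc
    have hsub : Metric.closedBall c (1 / 8) ⊆ Metric.ball 0 1 := fun w hw => by
      rw [mem_closedBall_iff_norm] at hw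
      rw [mem_ball_zero_iff]
      linarith [norm_sub_norm_le w c]
    -- Cauchy's estimate: discs of radius `1/8` about points with `|c| ≤ 1/8` stay in `|a| ≤ 1/4`,
    -- where the uniform bound holds. The radius is the source of the factor `8`.
    have := Complex.norm_deriv_le_of_forall_mem_sphere_norm_le (c := c) (R := 1 / 8)
      (C := C * (‖z‖ * Real.exp z.re)) (f := fun a => kummer a z) (by norm_num)
      (((differentiableOn_kummer_param z).mono hsub).diffContOnCl_ball subset_rfl)
      (fun w hw => h w (by
        rw [mem_sphere_iff_norm] at hw
        linarith [norm_sub_norm_le w c]) z hz)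
    refine this.trans (le_of_eq ?_)
    ring

end GrushinSymbol

/-! ## Asymptotics at parameter zero -/

namespace GrushinSymbol

/-- The reflection `t ↦ 1 - t` moves the endpoint where `e^(zt)` is largest to `0`, ready for
Laplace's method. -/
lemma kummer_zero_left_eq_integral (z : ℂ) :
    kummer 0 z = ∫ t in Ioo (0 : ℝ) 1, ((t ^ (-(1 / 2) : ℝ) : ℝ) : ℂ) *
      ((Complex.exp (z * (1 - t)) - 1) / (1 - t)) := by
  have h := kummer_eq_integral (a := 0) (by simp) z
  have hb : betaFactor 0 = 1 := by
    have : Complex.Gamma (1 / 2) ≠ 0 := Complex.Gamma_ne_zero_of_re_pos (by norm_num)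
    unfold betaFactor
    rw [zero_add, Complex.Gamma_one, sub_zero, inv_one, mul_one, mul_inv_cancel₀ this]
  rw [hb, one_mul, ← intervalIntegral.integral_of_le zero_le_one] at h
  have h2 := intervalIntegral.integral_comp_sub_left (a := 0) (b := 1)
    (fun t : ℝ => betaWeight 0 t * ((Complex.exp (z * t) - 1) / t)) 1
  rw [sub_self, sub_zero] at h2
  rw [h, ← h2, intervalIntegral.integral_of_le zero_le_one, integral_Ioc_eq_integral_Ioo]
  refine setIntegral_congr_fun measurableSet_Ioo fun t ht => ?_
  have : betaWeight 0 (1 - t) = ((t ^ (-(1 / 2) : ℝ) : ℝ) : ℂ) := by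
    rw [betaWeight, Complex.ofReal_cpow ht.1.le]
    norm_num
  simp only [this]
  push_cast
  rfl

/-- The substitution `t = x²` reduces this to the Gaussian integral with complex parameter. -/
lemma integral_rpow_mul_cexp {z : ℂ} (hz : 0 < z.re) :
    ∫ t in Ioi (0 : ℝ), ((t ^ (-(1 / 2) : ℝ) : ℝ) : ℂ) * Complex.exp (-z * t) =
      (Real.pi / z) ^ (1 / 2 : ℂ) := by
  have h := integral_comp_rpow_Ioi_of_pos
    (g := fun t : ℝ => ((t ^ (-(1 / 2) : ℝ) : ℝ) : ℂ) * Complex.exp (-z * t)) (p := 2) two_pos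
  have h2 : ∫ x in Ioi (0 : ℝ), ((2 : ℝ) * x ^ ((2 : ℝ) - 1)) •
      ((((x ^ (2 : ℝ)) ^ (-(1 / 2) : ℝ) : ℝ) : ℂ) * Complex.exp (-z * ((x ^ (2 : ℝ) : ℝ) : ℂ))) =
      ∫ x in Ioi (0 : ℝ), 2 * Complex.exp (-z * (x : ℂ) ^ 2) := by
    refine setIntegral_congr_fun measurableSet_Ioi fun x hx => ?_
    have hx0 : (0 : ℝ) < x := hx
    have h3 : (x ^ (2 : ℝ)) ^ (-(1 / 2) : ℝ) = x⁻¹ := by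
      rw [← Real.rpow_mul hx0.le, ← Real.rpow_neg_one]; norm_num
    have h4 : x ^ ((2 : ℝ) - 1) = x := by norm_num
    have h5 : (x : ℂ) ≠ 0 := by exact_mod_cast hx0.ne'
    simp only [h3, h4]
    rw [Complex.real_smul, Real.rpow_two]
    push_cast
    field_simp
  rw [← h, h2, integral_const_mul, integral_gaussian_complex_Ioi hz]
  ring

lemma norm_cexp_sub_cexp_le {z : ℂ} (hz : 0 ≤ z.re) {t : ℝ} (ht : t ≤ 1) :
    ‖Complex.exp (-z * t) - Complex.exp (-z)‖ ≤ ‖z‖ * (1 - t) * Real.exp (-z.re * t) := by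
  have h : Complex.exp (-z * t) - Complex.exp (-z) =
      -(Complex.exp (-z * t) * (Complex.exp (-(z * (1 - t))) - 1)) := by
    rw [mul_sub, ← Complex.exp_add, mul_one]
    ring_nf
  have h1 : 0 ≤ 1 - t := sub_nonneg.2 ht
  have h2 := norm_exp_neg_sub_one_le (v := z * (1 - t)) (by
    rw [← Complex.ofReal_one, ← Complex.ofReal_sub, Complex.re_mul_ofReal]
    positivity)
  rw [norm_mul, ← Complex.ofReal_one, ← Complex.ofReal_sub, Complex.norm_real,
    Real.norm_of_nonneg h1] at h2
  rw [h, norm_neg, norm_mul, Complex.norm_exp, mul_comm]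
  have h3 : (-z * t).re = -z.re * t := by simp
  rw [h3]
  gcongr
  push_cast at h2
  exact h2

lemma integrableOn_rpow_mul_exp_neg {s x : ℝ} (hs : 0 < s) (hx : 0 < x) :
    IntegrableOn (fun t : ℝ => t ^ (s - 1) * Real.exp (-(x * t))) (Ioi 0) := by
  -- The Bochner integral of a non-integrable function is `0`, so a nonzero value certifies
  -- integrability.
  refine .of_integral_ne_zero ?_
  rw [Real.integral_rpow_mul_exp_neg_mul_Ioi hs hx]
  have := Real.Gamma_pos_of_pos hs
  positivity

lemma rpow_neg_half_mul_self {t : ℝ} (ht : 0 < t) :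
    t ^ (-(1 / 2) : ℝ) * t = t ^ ((3 / 2 : ℝ) - 1) := by
  nth_rw 2 [← Real.rpow_one t]
  rw [← Real.rpow_add ht]
  norm_num

/-- The pointwise comparison of the integrand with that of the Gamma integral. -/
lemma norm_kernel_sub_le {z : ℂ} (hz : 0 < z.re) {t : ℝ} (ht : t ∈ Ioo (0 : ℝ) 1) :
    ‖((t ^ (-(1 / 2) : ℝ) : ℝ) : ℂ) *
        ((Complex.exp (-z * t) - Complex.exp (-z)) / (1 - t)) -
      ((t ^ (-(1 / 2) : ℝ) : ℝ) : ℂ) * Complex.exp (-z * t)‖ ≤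
      4 * (t ^ ((3 / 2 : ℝ) - 1) * Real.exp (-(z.re * t))) +
        (‖z‖ * Real.exp (-z.re / 2) + Real.exp (-z.re) * t ^ (-(1 / 2) : ℝ)) := by
  have h1 : 0 < 1 - t := sub_pos.2 ht.2
  have h1' : (1 : ℂ) - t ≠ 0 := by
    rw [← Complex.ofReal_one, ← Complex.ofReal_sub]; exact_mod_cast h1.ne'
  have ht0 := ht.1
  have hr : 0 < t ^ (-(1 / 2) : ℝ) := Real.rpow_pos_of_pos ht0 _
  -- This uses `1/(1 - t) = 1 + t/(1 - t)`: the extra factor `t` improves the decay of the error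
  -- from `(Re z)^(-1/2)` to `(Re z)^(-3/2)`.
  have heq : ((t ^ (-(1 / 2) : ℝ) : ℝ) : ℂ) *
        ((Complex.exp (-z * t) - Complex.exp (-z)) / (1 - t)) -
      ((t ^ (-(1 / 2) : ℝ) : ℝ) : ℂ) * Complex.exp (-z * t) =
      (((t ^ (-(1 / 2) : ℝ) * t : ℝ)) : ℂ) *
        ((Complex.exp (-z * t) - Complex.exp (-z)) / ((1 - t : ℝ) : ℂ)) -
      ((t ^ (-(1 / 2) : ℝ) : ℝ) : ℂ) * Complex.exp (-z) := by
    push_cast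
    field_simp
    ring
  have hn : ‖Complex.exp (-z)‖ = Real.exp (-z.re) := by rw [Complex.norm_exp]; simp
  have hnt : ‖Complex.exp (-z * t)‖ = Real.exp (-(z.re * t)) := by rw [Complex.norm_exp]; simp
  rw [heq]
  refine (norm_sub_le _ _).trans ?_
  rw [norm_mul, norm_mul, norm_div, Complex.norm_real, Complex.norm_real, Complex.norm_real,
    Real.norm_of_nonneg (by positivity), Real.norm_of_nonneg hr.le, Real.norm_of_nonneg h1.le, hn,
    mul_comm (t ^ (-(1 / 2) : ℝ)) (Real.exp _), ← add_assoc]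
  gcongr
  -- For `t ≤ 1/2` the denominator `1 - t` is at least `1/2`. For `t > 1/2` the mean value bound
  -- cancels `1 - t`, and the exponential is already at most `e^(-Re z / 2)`.
  rcases le_or_gt t (1 / 2) with h | h
  · rw [rpow_neg_half_mul_self ht0]
    have e1 : ‖Complex.exp (-z * t) - Complex.exp (-z)‖ ≤ 2 * Real.exp (-(z.re * t)) := by
      refine (norm_sub_le _ _).trans ?_
      rw [hn, hnt, two_mul]
      gcongr
      nlinarith
    have e2 : ‖Complex.exp (-z * t) - Complex.exp (-z)‖ / (1 - t) ≤
        4 * Real.exp (-(z.re * t)) := by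
      rw [div_le_iff₀ h1]
      nlinarith [Real.exp_pos (-(z.re * t))]
    have : 0 ≤ ‖z‖ * Real.exp (-z.re / 2) := by positivity
    have h0 : 0 ≤ t ^ ((3 / 2 : ℝ) - 1) := by positivity
    nlinarith
  · have e1 := norm_cexp_sub_cexp_le hz.le ht.2.le
    have e2 : ‖Complex.exp (-z * t) - Complex.exp (-z)‖ / (1 - t) ≤
        ‖z‖ * Real.exp (-z.re / 2) := by
      rw [div_le_iff₀ h1]
      refine e1.trans ?_
      rw [mul_right_comm]
      gcongr
      nlinarith
    have e3 : t ^ (-(1 / 2) : ℝ) * t ≤ 1 := by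
      rw [rpow_neg_half_mul_self ht0]
      exact Real.rpow_le_one ht0.le ht.2.le (by norm_num)
    have e4 : 0 ≤ 4 * (t ^ ((3 / 2 : ℝ) - 1) * Real.exp (-(z.re * t))) := by positivity
    calc _ ≤ 1 * (‖z‖ * Real.exp (-z.re / 2)) := by gcongr
      _ ≤ _ := by linarith

lemma integrableOn_rpow_neg_half :
    IntegrableOn (fun t : ℝ => t ^ (-(1 / 2) : ℝ)) (Ioo 0 1) := by
  have := intervalIntegral.intervalIntegrable_rpow' (a := 0) (b := 1) (r := -(1 / 2))
    (by norm_num)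
  rwa [intervalIntegrable_iff_integrableOn_Ioo_of_le zero_le_one] at this

lemma integral_rpow_neg_half : ∫ t in Ioo (0 : ℝ) 1, t ^ (-(1 / 2) : ℝ) = 2 := by
  rw [← integral_Ioc_eq_integral_Ioo, ← intervalIntegral.integral_of_le zero_le_one,
    integral_rpow (Or.inl (by norm_num))]
  norm_num

/-- The integrand on `(0, 1)`, extended by zero, is compared with the Gamma integrand on `(0, ∞)`.
The tail `t ≥ 1` is absorbed by the same majorant, since `t^(-1/2) ≤ t^(1/2)` there. -/
lemma norm_kummer_zero_sub_le {z : ℂ} (hz : 0 < z.re) :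
    ‖Complex.exp (-z) * kummer 0 z - (Real.pi / z) ^ (1 / 2 : ℂ)‖ ≤
      4 * ((1 / z.re) ^ (3 / 2 : ℝ) * Real.Gamma (3 / 2)) +
        (‖z‖ * Real.exp (-z.re / 2) + Real.exp (-z.re) * 2) := by
  set g : ℝ → ℂ := fun t => ((t ^ (-(1 / 2) : ℝ) : ℝ) : ℂ) *
    ((Complex.exp (-z * t) - Complex.exp (-z)) / (1 - t)) with hg
  set G : ℝ → ℂ := fun t => ((t ^ (-(1 / 2) : ℝ) : ℝ) : ℂ) * Complex.exp (-z * t) with hG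
  have hz0 : z ≠ 0 := fun h => by simp [h] at hz
  have hGi : IntegrableOn G (Ioi 0) := by
    refine .of_integral_ne_zero ?_
    rw [hG, integral_rpow_mul_cexp hz, Ne, Complex.cpow_eq_zero_iff, not_and_or]
    left
    have : (Real.pi : ℂ) ≠ 0 := by exact_mod_cast Real.pi_ne_zero
    exact div_ne_zero this hz0
  have hgi : IntegrableOn g (Ioo 0 1) := by
    refine Integrable.mono' (integrableOn_rpow_neg_half.mul_const ‖z‖) ?_ ?_
    · refine (Measurable.aestronglyMeasurable ?_)
      fun_prop
    · filter_upwards [ae_restrict_mem measurableSet_Ioo] with t ht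
      have h1 : 0 < 1 - t := sub_pos.2 ht.2
      have ht0 := ht.1
      rw [hg]
      simp only
      rw [← Complex.ofReal_one, ← Complex.ofReal_sub, norm_mul, norm_div, Complex.norm_real,
        Complex.norm_real, Real.norm_of_nonneg (by positivity), Real.norm_of_nonneg h1.le]
      gcongr
      rw [div_le_iff₀ h1]
      refine (norm_cexp_sub_cexp_le hz.le ht.2.le).trans (mul_le_of_le_one_right (by positivity) ?_)
      rw [Real.exp_le_one_iff]
      nlinarith
  have hk : Complex.exp (-z) * kummer 0 z = ∫ t in Ioi (0 : ℝ), (Ioo (0 : ℝ) 1).indicator g t := by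
    rw [setIntegral_indicator measurableSet_Ioo,
      inter_eq_self_of_subset_right (Ioo_subset_Ioi_self : Ioo (0 : ℝ) 1 ⊆ Ioi 0),
      kummer_zero_left_eq_integral, ← integral_const_mul]
    refine setIntegral_congr_fun measurableSet_Ioo fun t ht => ?_
    have : Complex.exp (-z * t) = Complex.exp (-z) * Complex.exp (z * (1 - t)) := by
      rw [← Complex.exp_add]; ring_nf
    simp only [hg, this]
    ring
  have hgi' : IntegrableOn ((Ioo (0 : ℝ) 1).indicator g) (Ioi 0) :=
    (hgi.integrable_indicator measurableSet_Ioo).integrableOn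
  rw [hk, ← integral_rpow_mul_cexp hz, ← integral_sub hgi' hGi]
  have i1 := (integrableOn_rpow_mul_exp_neg (s := 3 / 2) (by norm_num) hz).const_mul 4
  have i3 : Integrable (fun _ : ℝ => ‖z‖ * Real.exp (-z.re / 2)) (volume.restrict (Ioo 0 1)) :=
    integrable_const _
  have i2 : IntegrableOn (fun t : ℝ =>
      ‖z‖ * Real.exp (-z.re / 2) + Real.exp (-z.re) * t ^ (-(1 / 2) : ℝ)) (Ioo 0 1) :=
    i3.add (integrableOn_rpow_neg_half.const_mul _)
  have i2' := (i2.integrable_indicator measurableSet_Ioo).integrableOn (s := Ioi 0)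
  refine (norm_integral_le_of_norm_le (i1.add i2') ?_).trans (le_of_eq ?_)
  · filter_upwards [ae_restrict_mem measurableSet_Ioi] with t ht
    have ht0 : 0 < t := ht
    rcases lt_or_ge t 1 with h | h
    · have hm : t ∈ Ioo (0 : ℝ) 1 := ⟨ht, h⟩
      simp only [Pi.add_apply, indicator_of_mem hm]
      exact norm_kernel_sub_le hz hm
    · have hm : t ∉ Ioo (0 : ℝ) 1 := fun hm => absurd hm.2 (not_lt.2 h)
      simp only [Pi.add_apply, indicator_of_notMem hm, zero_sub, norm_neg, add_zero]
      rw [norm_mul, Complex.norm_real, Real.norm_of_nonneg (by positivity), Complex.norm_exp]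
      have e1 : (-z * t).re = -(z.re * t) := by simp
      rw [e1, ← mul_assoc]
      gcongr
      rw [← rpow_neg_half_mul_self ht0]
      have : 0 < t ^ (-(1 / 2) : ℝ) := by positivity
      nlinarith
  · have j1 : ∫ t in Ioo (0 : ℝ) 1, (‖z‖ * Real.exp (-z.re / 2)) = ‖z‖ * Real.exp (-z.re / 2) := by
      simp
    simp only [Pi.add_apply]
    rw [integral_add i1 i2', integral_const_mul,
      Real.integral_rpow_mul_exp_neg_mul_Ioi (by norm_num) hz,
      setIntegral_indicator measurableSet_Ioo,
      inter_eq_self_of_subset_right (Ioo_subset_Ioi_self : Ioo (0 : ℝ) 1 ⊆ Ioi 0),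
      integral_add i3 (integrableOn_rpow_neg_half.const_mul _),
      j1, integral_const_mul, integral_rpow_neg_half]

lemma tendsto_norm_kummer_zero_bound {c : ℝ} (hc : 0 < c) :
    Tendsto (fun x : ℝ => (x / c) ^ (1 / 2 : ℝ) *
      (4 * ((1 / x) ^ (3 / 2 : ℝ) * Real.Gamma (3 / 2)) +
        (x / c * Real.exp (-x / 2) + Real.exp (-x) * 2))) atTop (𝓝 0) := by
  have t1 : Tendsto (fun x : ℝ => x⁻¹) atTop (𝓝 0) := tendsto_inv_atTop_zero
  have t2 := tendsto_rpow_mul_exp_neg_mul_atTop_nhds_zero (3 / 2) (1 / 2) (by norm_num)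
  have t3 := tendsto_rpow_mul_exp_neg_mul_atTop_nhds_zero (1 / 2) 1 (by norm_num)
  have t := (((t1.const_mul (4 * Real.Gamma (3 / 2))).add
    ((t2.const_mul (1 / c)).add (t3.const_mul 2)))).const_mul ((1 / c) ^ (1 / 2 : ℝ))
  simp only [mul_zero, add_zero] at t
  refine t.congr' ?_
  filter_upwards [eventually_gt_atTop 0] with x hx
  have e1 : (x / c) ^ (1 / 2 : ℝ) = (1 / c) ^ (1 / 2 : ℝ) * x ^ (1 / 2 : ℝ) := by
    rw [← Real.mul_rpow (by positivity) hx.le]; ring_nf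
  have e2 : x ^ (1 / 2 : ℝ) * (1 / x) ^ (3 / 2 : ℝ) = x⁻¹ := by
    rw [one_div x, Real.inv_rpow hx.le, ← Real.rpow_neg hx.le, ← Real.rpow_add hx,
      ← Real.rpow_neg_one]
    norm_num
  have e3 : x ^ (3 / 2 : ℝ) = x ^ (1 / 2 : ℝ) * x := by
    nth_rw 3 [← Real.rpow_one x]
    rw [← Real.rpow_add hx]; norm_num
  have e4 : -(1 / 2) * x = -x / 2 := by ring
  have e5 : -1 * x = -x := by ring
  rw [e1, e3, e4, e5, ← e2]
  ring

/-- The filter of neighbourhoods of infinity in the cone `c |z| ≤ Re z`. -/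
noncomputable def coneAtInfinity (c : ℝ) : Filter ℂ := Bornology.cobounded ℂ ⊓ 𝓟 {z | c * ‖z‖ ≤ z.re}

lemma eventually_cone (c : ℝ) : ∀ᶠ z in coneAtInfinity c, c * ‖z‖ ≤ z.re :=
  mem_inf_of_right (mem_principal_self _)

lemma tendsto_norm_coneAtInfinity (c : ℝ) : Tendsto (fun z : ℂ => ‖z‖) (coneAtInfinity c) atTop :=
  tendsto_norm_cobounded_atTop.mono_left inf_le_left

lemma tendsto_re_coneAtInfinity {c : ℝ} (hc : 0 < c) :
    Tendsto Complex.re (coneAtInfinity c) atTop :=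
  tendsto_atTop_mono' _ (eventually_cone c) ((tendsto_norm_coneAtInfinity c).const_mul_atTop hc)

lemma pi_div_cpow_mul_cpow {z : ℂ} (hz : 0 < z.re) :
    (Real.pi / z) ^ (1 / 2 : ℂ) * z ^ (1 / 2 : ℂ) = (Real.sqrt Real.pi : ℝ) := by
  have hz0 : z ≠ 0 := fun h => by simp [h] at hz
  have hpi := Real.pi_pos
  have harg : z.arg ≠ Real.pi := by
    have := Complex.abs_arg_lt_pi_div_two_iff.2 (Or.inl hz)
    rw [abs_lt] at this
    linarith [this.2]
  have hpi0 : (Real.pi : ℂ) ≠ 0 := by exact_mod_cast hpi.ne'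
  rw [Complex.cpow_def_of_ne_zero (div_ne_zero hpi0 hz0), Complex.cpow_def_of_ne_zero hz0,
    div_eq_mul_inv, Complex.log_ofReal_mul hpi (inv_ne_zero hz0), Complex.log_inv _ harg,
    ← Complex.exp_add, Real.sqrt_eq_rpow, Complex.ofReal_cpow hpi.le,
    Complex.cpow_def_of_ne_zero hpi0, Complex.ofReal_log hpi.le]
  push_cast
  ring_nf

/-- `kummer 0 z ∼ √π e ^ z z ^ (-1/2)` at infinity in a cone. -/
lemma tendsto_kummer_zero {c : ℝ} (hc : 0 < c) :
    Tendsto (fun z : ℂ => Complex.exp (-z) * kummer 0 z * z ^ (1 / 2 : ℂ)) (coneAtInfinity c)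
      (𝓝 (Real.sqrt Real.pi : ℝ)) := by
  rw [tendsto_iff_norm_sub_tendsto_zero]
  refine squeeze_zero' (Eventually.of_forall fun z => norm_nonneg _) ?_
    ((tendsto_norm_kummer_zero_bound hc).comp (tendsto_re_coneAtInfinity hc))
  filter_upwards [eventually_cone c, (tendsto_re_coneAtInfinity hc).eventually_gt_atTop 0]
    with z hz hz0
  have h1 : ‖z‖ ≤ z.re / c := by rw [le_div_iff₀ hc]; linarith
  have h2 : ‖z ^ (1 / 2 : ℂ)‖ ≤ (z.re / c) ^ (1 / 2 : ℝ) := by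
    have : (1 / 2 : ℂ) = ((1 / 2 : ℝ) : ℂ) := by norm_num
    rw [this, Complex.norm_cpow_real]
    gcongr
  rw [← pi_div_cpow_mul_cpow hz0, ← sub_mul, norm_mul, mul_comm]
  simp only [Function.comp_apply]
  have h3 := norm_kummer_zero_sub_le hz0
  gcongr
  refine h3.trans ?_
  gcongr

end GrushinSymbol

/-! ## The small root of Kummer's function in its first parameter -/

namespace GrushinSymbol

/-- A Lipschitz bound for `a ↦ kummer a z` near `0`. -/
noncomputable def lipBound (z : ℂ) : ℝ :=
  exists_kummer_lipschitz.choose * (‖z‖ * Real.exp z.re)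

lemma norm_kummer_sub_le {z a b : ℂ} (hz : 0 ≤ z.re) (ha : ‖a‖ ≤ 1 / 8) (hb : ‖b‖ ≤ 1 / 8) :
    ‖kummer a z - kummer b z‖ ≤ lipBound z * ‖a - b‖ :=
  exists_kummer_lipschitz.choose_spec.2 z hz a b ha hb

lemma lipBound_nonneg (z : ℂ) : 0 ≤ lipBound z :=
  mul_nonneg exists_kummer_lipschitz.choose_spec.1.le (by positivity)

lemma continuous_lipBound : Continuous lipBound := by
  unfold lipBound
  fun_prop

/-- The region in which `a ↦ -1 / kummer a z` is a contraction of a small disc. -/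
def rootDomain : Set ℂ :=
  {z | 0 < z.re ∧ 16 < ‖kummer 0 z‖ ∧ 16 * lipBound z < ‖kummer 0 z‖ ^ 2}

lemma isOpen_rootDomain : IsOpen rootDomain := by
  have h : Continuous (kummer 0) := (differentiable_kummer (by simp)).continuous
  refine (isOpen_lt continuous_const Complex.continuous_re).inter
    ((isOpen_lt continuous_const h.norm).inter
      (isOpen_lt (continuous_const.mul continuous_lipBound) (h.norm.pow 2)))

lemma two_div_norm_kummer_le {z : ℂ} (hz : z ∈ rootDomain) : 2 / ‖kummer 0 z‖ ≤ 1 / 8 := by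
  rw [div_le_div_iff₀ (by linarith [hz.2.1]) (by norm_num)]
  linarith [hz.2.1]

lemma norm_kummer_sub_zero_le {z a : ℂ} (hz : z ∈ rootDomain) (ha : ‖a‖ ≤ 2 / ‖kummer 0 z‖) :
    ‖kummer a z - kummer 0 z‖ ≤ lipBound z * (2 / ‖kummer 0 z‖) := by
  refine (norm_kummer_sub_le hz.1.le (ha.trans (two_div_norm_kummer_le hz)) (by simp)).trans ?_
  rw [sub_zero]
  exact mul_le_mul_of_nonneg_left ha (lipBound_nonneg z)

/-- On the disc the variation of `kummer` is at most `2L / |K(0, z)|` with `L = lipBound z`, and `16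
L < |K(0, z)|²` makes this less than half of `|K(0, z)|`. -/
lemma half_le_norm_kummer {z a : ℂ} (hz : z ∈ rootDomain) (ha : ‖a‖ ≤ 2 / ‖kummer 0 z‖) :
    ‖kummer 0 z‖ / 2 ≤ ‖kummer a z‖ := by
  have h0 : 0 < ‖kummer 0 z‖ := by linarith [hz.2.1]
  have h1 := norm_kummer_sub_zero_le hz ha
  have h2 : lipBound z * (2 / ‖kummer 0 z‖) ≤ ‖kummer 0 z‖ / 2 := by
    rw [mul_div_assoc', div_le_iff₀ h0]
    nlinarith [hz.2.2, lipBound_nonneg z]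
  have h3 := norm_sub_norm_le (kummer 0 z) (kummer a z)
  rw [norm_sub_rev] at h3
  linarith

lemma kummer_ne_zero {z a : ℂ} (hz : z ∈ rootDomain) (ha : ‖a‖ ≤ 2 / ‖kummer 0 z‖) :
    kummer a z ≠ 0 := by
  rw [← norm_pos_iff]
  linarith [half_le_norm_kummer hz ha, hz.2.1]

lemma norm_neg_inv_kummer_le {z a : ℂ} (hz : z ∈ rootDomain) (ha : ‖a‖ ≤ 2 / ‖kummer 0 z‖) :
    ‖-(kummer a z)⁻¹‖ ≤ 2 / ‖kummer 0 z‖ := by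
  have h := half_le_norm_kummer hz ha
  have h0 : 0 < ‖kummer 0 z‖ := by linarith [hz.2.1]
  rw [norm_neg, norm_inv, inv_le_comm₀ (by linarith) (by positivity), inv_div]
  exact h

/-- The difference of the inverses is at most `L|a - b|` divided by `(|K(0, z)|/2)²`; the constant
`16` in `rootDomain` is chosen to give the ratio `1/4`. -/
lemma neg_inv_kummer_contract {z a b : ℂ} (hz : z ∈ rootDomain) (ha : ‖a‖ ≤ 2 / ‖kummer 0 z‖)
    (hb : ‖b‖ ≤ 2 / ‖kummer 0 z‖) :
    ‖-(kummer a z)⁻¹ - -(kummer b z)⁻¹‖ ≤ 1 / 4 * ‖a - b‖ := by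
  have h0 : 0 < ‖kummer 0 z‖ := by linarith [hz.2.1]
  have ha1 := half_le_norm_kummer hz ha
  have hb1 := half_le_norm_kummer hz hb
  have e : -(kummer a z)⁻¹ - -(kummer b z)⁻¹ =
      (kummer a z - kummer b z) / (kummer a z * kummer b z) := by
    have := kummer_ne_zero hz ha
    have := kummer_ne_zero hz hb
    field_simp
    ring
  have h1 := norm_kummer_sub_le hz.1.le (ha.trans (two_div_norm_kummer_le hz))
    (hb.trans (two_div_norm_kummer_le hz))
  rw [e, norm_div, norm_mul, div_le_iff₀ (mul_pos (by linarith) (by linarith))]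
  refine h1.trans ?_
  have h2 : ‖kummer 0 z‖ / 2 * (‖kummer 0 z‖ / 2) ≤ ‖kummer a z‖ * ‖kummer b z‖ := by gcongr
  have h3 : lipBound z ≤ 1 / 4 * (‖kummer a z‖ * ‖kummer b z‖) := by nlinarith [hz.2.2]
  calc _ ≤ 1 / 4 * (‖kummer a z‖ * ‖kummer b z‖) * ‖a - b‖ := by gcongr
    _ = _ := by ring

/-- The iterates of `a ↦ -1 / kummer a z` from `0`. -/
noncomputable def rootIter : ℕ → ℂ → ℂ
  | 0, _ => 0
  | n + 1, z => -(kummer (rootIter n z) z)⁻¹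

lemma norm_rootIter_le {z : ℂ} (hz : z ∈ rootDomain) (n : ℕ) :
    ‖rootIter n z‖ ≤ 2 / ‖kummer 0 z‖ := by
  induction n with
  | zero => simp only [rootIter, norm_zero]; positivity
  | succ n ih => exact norm_neg_inv_kummer_le hz ih

lemma norm_rootIter_succ_sub_le {z : ℂ} (hz : z ∈ rootDomain) (n : ℕ) :
    ‖rootIter (n + 1) z - rootIter n z‖ ≤ (1 / 4) ^ n := by
  induction n with
  | zero =>
    have h : rootIter 0 z = 0 := rfl
    rw [h, sub_zero, pow_zero]
    exact (norm_rootIter_le hz 1).trans ((two_div_norm_kummer_le hz).trans (by norm_num))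
  | succ n ih =>
    refine (neg_inv_kummer_contract hz (norm_rootIter_le hz (n + 1)) (norm_rootIter_le hz n)).trans
      ?_
    rw [pow_succ']
    gcongr

lemma differentiableOn_rootIter (n : ℕ) : DifferentiableOn ℂ (rootIter n) rootDomain := by
  induction n with
  | zero => exact differentiableOn_const 0
  | succ n ih =>
    refine ((differentiableOn_kummer_comp isOpen_rootDomain ih differentiableOn_id
      fun z hz => ?_).inv fun z hz => kummer_ne_zero hz (norm_rootIter_le hz n)).neg
    exact ((norm_rootIter_le hz n).trans (two_div_norm_kummer_le hz)).trans (by norm_num)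

/-- The small root `a` of `M(a, 1/2, z) = 1 + a * kummer a z`. -/
noncomputable def root (z : ℂ) : ℂ := ∑' n : ℕ, (rootIter (n + 1) z - rootIter n z)

lemma summable_quarter_pow : Summable fun n : ℕ => (1 / 4 : ℝ) ^ n :=
  summable_geometric_of_lt_one (by norm_num) (by norm_num)

/-- The telescoping series of the iterates has the uniform majorant `(1/4)^n`, so Weierstrass'
theorem gives holomorphy without an implicit function theorem. -/
lemma differentiableOn_root : DifferentiableOn ℂ root rootDomain :=
  Complex.differentiableOn_tsum_of_summable_norm summable_quarter_pow
    (fun n => (differentiableOn_rootIter (n + 1)).sub (differentiableOn_rootIter n))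
    isOpen_rootDomain fun n _ hz => norm_rootIter_succ_sub_le hz n

lemma tendsto_rootIter {z : ℂ} (hz : z ∈ rootDomain) :
    Tendsto (fun n => rootIter n z) atTop (𝓝 (root z)) := by
  have h := (Summable.of_norm_bounded summable_quarter_pow
    (norm_rootIter_succ_sub_le hz)).hasSum.tendsto_sum_nat
  refine h.congr fun n => ?_
  rw [Finset.sum_range_sub (fun n => rootIter n z)]
  simp [rootIter]

lemma norm_root_le {z : ℂ} (hz : z ∈ rootDomain) : ‖root z‖ ≤ 2 / ‖kummer 0 z‖ :=
  le_of_tendsto (tendsto_rootIter hz).norm (Eventually.of_forall (norm_rootIter_le hz))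

lemma norm_root_le_eighth {z : ℂ} (hz : z ∈ rootDomain) : ‖root z‖ ≤ 1 / 8 :=
  (norm_root_le hz).trans (two_div_norm_kummer_le hz)

lemma root_eq {z : ℂ} (hz : z ∈ rootDomain) : root z = -(kummer (root z) z)⁻¹ := by
  have h1 := (tendsto_rootIter hz).comp (tendsto_add_atTop_nat 1)
  have hc : ContinuousAt (fun a => kummer a z) (root z) :=
    ((differentiableOn_kummer_param z).differentiableAt (Metric.isOpen_ball.mem_nhds
      (mem_ball_zero_iff.2 ((norm_root_le_eighth hz).trans_lt (by norm_num))))).continuousAt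
  have h2 := ((hc.tendsto.comp (tendsto_rootIter hz)).inv₀ (kummer_ne_zero hz (norm_root_le hz))).neg
  exact tendsto_nhds_unique h1 h2

lemma one_add_root_mul_kummer {z : ℂ} (hz : z ∈ rootDomain) :
    1 + root z * kummer (root z) z = 0 := by
  have h := kummer_ne_zero hz (norm_root_le hz)
  have : root z * kummer (root z) z = -1 := by
    nth_rw 1 [root_eq hz]
    rw [neg_mul, inv_mul_cancel₀ h]
  rw [this]; ring

/-- The root is real at real points. -/
lemma root_ofReal {t : ℝ} (ht : (t : ℂ) ∈ rootDomain) : root t = ((root t).re : ℂ) := by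
  set b := (starRingEnd ℂ) (root t) with hb
  have hbn : ‖b‖ ≤ 2 / ‖kummer 0 t‖ := by rw [hb, RCLike.norm_conj]; exact norm_root_le ht
  have hbf : b = -(kummer b t)⁻¹ := by
    have h := congrArg (starRingEnd ℂ) (root_eq ht)
    rw [map_neg, map_inv₀, ← kummer_conj, Complex.conj_ofReal] at h
    exact h
  -- The conjugate of the root is a fixed point in the same disc, and a contraction has only one.
  have h := neg_inv_kummer_contract ht (norm_root_le ht) hbn
  rw [← root_eq ht, ← hbf] at h
  have h0 : ‖root t - b‖ = 0 := by linarith [norm_nonneg (root t - b)]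
  rw [norm_eq_zero, sub_eq_zero] at h0
  exact (Complex.conj_eq_iff_re.1 h0.symm).symm

/-! ## The domain contains truncated sectors -/

lemma norm_kummer_zero_eq {z : ℂ} (hz : z ≠ 0) :
    ‖kummer 0 z‖ = ‖Complex.exp (-z) * kummer 0 z * z ^ (1 / 2 : ℂ)‖ * Real.exp z.re *
      ‖z‖ ^ (-(1 / 2) : ℝ) := by
  have h : (1 / 2 : ℂ) = ((1 / 2 : ℝ) : ℂ) := by norm_num
  have hz' : 0 < ‖z‖ := norm_pos_iff.2 hz
  have e1 : Real.exp (-z.re) * Real.exp z.re = 1 := by rw [← Real.exp_add]; simp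
  have e2 : ‖z‖ ^ (1 / 2 : ℝ) * ‖z‖ ^ (-(1 / 2) : ℝ) = 1 := by
    rw [← Real.rpow_add hz']; simp
  rw [norm_mul, norm_mul, h, Complex.norm_cpow_real, Complex.norm_exp, Complex.neg_re]
  linear_combination (-‖kummer 0 z‖ * ‖z‖ ^ (1 / 2 : ℝ) * ‖z‖ ^ (-(1 / 2) : ℝ)) * e1 -
    ‖kummer 0 z‖ * e2

/-- The quotient is of order `|z|² e^(-Re z)`, and `|z| ≤ Re z / c` in the cone, so the exponential
wins. -/
lemma tendsto_lipBound_div {c : ℝ} (hc : 0 < c) :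
    Tendsto (fun z => lipBound z / ‖kummer 0 z‖ ^ 2) (coneAtInfinity c) (𝓝 0) := by
  set K := exists_kummer_lipschitz.choose with hK
  have hK0 : 0 < K := exists_kummer_lipschitz.choose_spec.1
  have hs : (Real.sqrt Real.pi) ≠ 0 := by have := Real.pi_pos; positivity
  have h1 := (tendsto_kummer_zero hc).norm
  rw [Complex.norm_real, Real.norm_of_nonneg (Real.sqrt_nonneg _)] at h1
  have h2 := (tendsto_rpow_mul_exp_neg_mul_atTop_nhds_zero 2 1 one_pos).comp
    (tendsto_re_coneAtInfinity hc)
  have h3 := (h2.const_mul (K / c ^ 2)).div (h1.pow 2) (pow_ne_zero 2 hs)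
  rw [mul_zero, zero_div] at h3
  refine squeeze_zero' (Eventually.of_forall fun z => div_nonneg (lipBound_nonneg z) (sq_nonneg _))
    ?_ h3
  filter_upwards [eventually_cone c, (tendsto_re_coneAtInfinity hc).eventually_gt_atTop 0,
    h1.eventually_ne hs] with z hz hz0 hQ
  have hzne : z ≠ 0 := fun h => by simp [h] at hz0
  have hz' : 0 < ‖z‖ := norm_pos_iff.2 hzne
  have h4 : ‖z‖ ≤ z.re / c := by rw [le_div_iff₀ hc]; linarith
  have hQ' : 0 < ‖Complex.exp (-z) * kummer 0 z * z ^ (1 / 2 : ℂ)‖ :=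
    lt_of_le_of_ne (norm_nonneg _) (Ne.symm hQ)
  have e2 : (‖z‖ ^ (-(1 / 2) : ℝ)) ^ 2 = ‖z‖⁻¹ := by
    rw [← Real.rpow_natCast, ← Real.rpow_mul hz'.le, ← Real.rpow_neg_one]; norm_num
  have e3 : Real.exp (-1 * z.re) = (Real.exp z.re)⁻¹ := by rw [← Real.exp_neg]; simp
  rw [norm_kummer_zero_eq hzne, lipBound, ← hK]
  simp only [Function.comp_apply, Pi.div_apply]
  generalize ‖Complex.exp (-z) * kummer 0 z * z ^ (1 / 2 : ℂ)‖ = Q at *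
  rw [mul_pow, mul_pow, e2, e3, Real.rpow_two]
  have hexp := Real.exp_pos z.re
  have e4 : K * (‖z‖ * Real.exp z.re) / (Q ^ 2 * Real.exp z.re ^ 2 * ‖z‖⁻¹) =
      K * ‖z‖ ^ 2 * (Real.exp z.re)⁻¹ / Q ^ 2 := by
    field_simp
  have e5 : K / c ^ 2 * (z.re ^ 2 * (Real.exp z.re)⁻¹) / Q ^ 2 =
      K * (z.re / c) ^ 2 * (Real.exp z.re)⁻¹ / Q ^ 2 := by
    field_simp
  rw [e4, e5]
  gcongr

lemma tendsto_lipBound_atTop {c : ℝ} (hc : 0 < c) :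
    Tendsto lipBound (coneAtInfinity c) atTop := by
  have hK0 : 0 < exists_kummer_lipschitz.choose := exists_kummer_lipschitz.choose_spec.1
  refine tendsto_atTop_mono' _ ?_ ((tendsto_norm_coneAtInfinity c).const_mul_atTop hK0)
  filter_upwards [(tendsto_re_coneAtInfinity hc).eventually_gt_atTop 0] with z hz
  unfold lipBound
  gcongr
  exact le_mul_of_one_le_right (norm_nonneg _) (Real.one_le_exp hz.le)

lemma eventually_mem_rootDomain {c : ℝ} (hc : 0 < c) :
    ∀ᶠ z in coneAtInfinity c, z ∈ rootDomain := by
  filter_upwards [(tendsto_re_coneAtInfinity hc).eventually_gt_atTop 0,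
    (tendsto_lipBound_div hc).eventually_lt_const (show (0 : ℝ) < 1 / 16 by norm_num),
    (tendsto_lipBound_atTop hc).eventually_gt_atTop 16,
    ((tendsto_kummer_zero hc).norm).eventually_ne (b₂ := (0 : ℝ)) (by
      have := Real.pi_pos
      rw [Complex.norm_real, Real.norm_of_nonneg (Real.sqrt_nonneg _)]
      positivity)] with z h1 h2 h3 h4
  have h0 : 0 < ‖kummer 0 z‖ := norm_pos_iff.2 fun h => h4 (by simp [h])
  rw [div_lt_iff₀ (by positivity)] at h2
  refine ⟨h1, ?_, by linarith⟩
  -- From `lipBound z > 16` and `16 * lipBound z < ‖kummer 0 z‖ ^ 2` follows `‖kummer 0 z‖ > 16`.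
  nlinarith

lemma cos_mul_norm_le_re {θ R : ℝ} (hθ : θ ≤ Real.pi) {z : ℂ} (hz : z ∈ sector θ R) :
    Real.cos θ * ‖z‖ ≤ z.re := by
  rw [← Complex.norm_mul_cos_arg z, mul_comm]
  gcongr
  rw [← Real.cos_abs z.arg]
  exact Real.cos_le_cos_of_nonneg_of_le_pi (abs_nonneg _) hθ hz.2.le

lemma sector_filter_le {θ : ℝ} (hθ : θ ≤ Real.pi) (R : ℝ) :
    Bornology.cobounded ℂ ⊓ 𝓟 (sector θ R) ≤ coneAtInfinity (Real.cos θ) :=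
  inf_le_inf_left _ (principal_mono.2 fun _ hz => cos_mul_norm_le_re hθ hz)

lemma sector_mono {θ θ' R R' : ℝ} (hθ : θ ≤ θ') (hR : R' ≤ R) : sector θ R ⊆ sector θ' R' :=
  fun _ hz => ⟨hR.trans_lt hz.1, hz.2.trans_le hθ⟩

lemma eventually_cobounded_inf_principal {s : Set ℂ} {p : ℂ → Prop}
    (h : ∀ᶠ z in Bornology.cobounded ℂ ⊓ 𝓟 s, p z) :
    ∃ R : ℝ≥0, ∀ z ∈ s, (R : ℝ) < ‖z‖ → p z := by
  rw [eventually_inf_principal, ← comap_norm_atTop, eventually_comap] at h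
  obtain ⟨R, hR⟩ := eventually_atTop.1 h
  exact ⟨R.toNNReal, fun z hz hRz => hR ‖z‖ ((Real.le_coe_toNNReal R).trans hRz.le) z rfl hz⟩

/-- The radii beyond which the sector of half-angle `θ` lies in `rootDomain`. -/
def admissibleRadii (θ : ℝ) : Set ℝ≥0 := {R | sector θ R ⊆ rootDomain}

lemma cos_pos_of_mem (θ : Ioo (0 : ℝ) (Real.pi / 2)) : 0 < Real.cos θ :=
  Real.cos_pos_of_mem_Ioo ⟨by linarith [θ.2.1, Real.pi_pos], θ.2.2⟩

lemma le_pi_of_mem (θ : Ioo (0 : ℝ) (Real.pi / 2)) : (θ : ℝ) ≤ Real.pi := by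
  linarith [θ.2.2, Real.pi_pos]

lemma admissibleRadii_nonempty (θ : Ioo (0 : ℝ) (Real.pi / 2)) :
    (admissibleRadii θ).Nonempty := by
  obtain ⟨R, hR⟩ := eventually_cobounded_inf_principal
    ((eventually_mem_rootDomain (cos_pos_of_mem θ)).filter_mono
      (sector_filter_le (le_pi_of_mem θ) 0))
  exact ⟨R, fun z hz => hR z (sector_mono le_rfl R.2 hz) hz.1⟩

/-- The radius function of the symbol. -/
noncomputable def symbolRadius (θ : Ioo (0 : ℝ) (Real.pi / 2)) : ℝ≥0 := sInf (admissibleRadii θ)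

lemma monotone_symbolRadius : Monotone symbolRadius := fun _ θ' h =>
  csInf_le_csInf (OrderBot.bddBelow _) (admissibleRadii_nonempty θ')
    fun R hR => (sector_mono h (le_refl (R : ℝ))).trans hR

/-- The infimum of the admissible radii is itself admissible because sectors are defined by the
strict inequality `R < ‖z‖`. -/
lemma sector_subset_rootDomain (θ : Ioo (0 : ℝ) (Real.pi / 2)) :
    sector θ (symbolRadius θ) ⊆ rootDomain := by
  intro z hz
  have h : symbolRadius θ < ‖z‖₊ := by
    rw [← NNReal.coe_lt_coe, coe_nnnorm]; exact hz.1
  obtain ⟨R, hR, hRz⟩ := exists_lt_of_csInf_lt (admissibleRadii_nonempty θ) h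
  exact hR ⟨by rw [← coe_nnnorm]; exact_mod_cast hRz, hz.2⟩

/-! ## The symbol -/

/-- The symbol `γ(z) = -4 z e ^ z a(z)`. -/
noncomputable def symbol (z : ℂ) : ℂ := -4 * z * Complex.exp z * root z

lemma tendsto_kummer_root_div {c : ℝ} (hc : 0 < c) :
    Tendsto (fun z => kummer (root z) z / kummer 0 z) (coneAtInfinity c) (𝓝 1) := by
  rw [tendsto_iff_norm_sub_tendsto_zero]
  have h := (tendsto_lipBound_div hc).const_mul 2
  rw [mul_zero] at h
  refine squeeze_zero' (Eventually.of_forall fun z => norm_nonneg _) ?_ h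
  filter_upwards [eventually_mem_rootDomain hc] with z hz
  have h0 : 0 < ‖kummer 0 z‖ := by linarith [hz.2.1]
  have h1 := norm_kummer_sub_zero_le hz (norm_root_le hz)
  rw [div_sub_one (norm_pos_iff.1 h0), norm_div, div_le_iff₀ h0]
  refine h1.trans (le_of_eq ?_)
  field_simp

/-- The fixed point equation turns the symbol into `4 z e^z / K(root z, z)`. Here `K(root z, z)` may
be replaced by `K(0, z)`, whose asymptotics are known. -/
lemma symbol_isEquivalent {c : ℝ} (hc : 0 < c) :
    IsEquivalent (coneAtInfinity c) symbol (fun α : ℂ =>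
      4 * ((Real.pi ^ (-(1 / 2 : ℝ)) : ℝ) : ℂ) * α ^ (3 / 2 : ℂ)) := by
  have hs : ((Real.sqrt Real.pi : ℝ) : ℂ) ≠ 0 := by
    have := Real.pi_pos
    exact_mod_cast (show Real.sqrt Real.pi ≠ 0 by positivity)
  have hpi : ((Real.pi ^ (-(1 / 2 : ℝ)) : ℝ) : ℂ) = ((Real.sqrt Real.pi : ℝ) : ℂ)⁻¹ := by
    rw [Real.rpow_neg Real.pi_pos.le, ← Real.sqrt_eq_rpow, Complex.ofReal_inv]
  have hev : ∀ᶠ z in coneAtInfinity c, z ≠ 0 := by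
    filter_upwards [(tendsto_re_coneAtInfinity hc).eventually_gt_atTop 0] with z hz h
    simp [h] at hz
  rw [isEquivalent_iff_tendsto_one]
  · have h := ((tendsto_const_nhds (x := ((Real.sqrt Real.pi : ℝ) : ℂ))).div
      (tendsto_kummer_zero hc) hs).div
      (tendsto_kummer_root_div hc) one_ne_zero
    rw [div_self hs, div_one] at h
    refine h.congr' ?_
    filter_upwards [hev, eventually_mem_rootDomain hc] with z hz hzD
    have h1 := kummer_ne_zero hzD (norm_root_le hzD)
    have h2 : kummer 0 z ≠ 0 := norm_pos_iff.1 (by linarith [hzD.2.1])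
    have h3 : z ^ (1 / 2 : ℂ) ≠ 0 := by rw [Ne, Complex.cpow_eq_zero_iff]; simp [hz]
    have h4 : z ^ (3 / 2 : ℂ) = z * z ^ (1 / 2 : ℂ) := by
      nth_rw 2 [← Complex.cpow_one z]
      rw [← Complex.cpow_add _ _ hz]; norm_num
    have h5 : symbol z = 4 * z * Complex.exp z * (kummer (root z) z)⁻¹ := by
      rw [symbol]; nth_rw 1 [root_eq hzD]; ring
    simp only [Pi.div_apply]
    rw [h5, h4, hpi, Complex.exp_neg]
    have h6 := Complex.exp_ne_zero z
    field_simp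
  · filter_upwards [hev] with z hz
    rw [hpi]
    refine mul_ne_zero (mul_ne_zero (by norm_num) (inv_ne_zero hs)) ?_
    rw [Ne, Complex.cpow_eq_zero_iff]; simp [hz]

lemma tendsto_symbol_mul_exp {c ε : ℝ} (hc : 0 < c) (hε : 0 < ε) :
    Tendsto (fun z => ‖symbol z‖ * Real.exp (-ε * ‖z‖)) (coneAtInfinity c) (𝓝 0) := by
  have h1 : (fun z => ‖symbol z‖ * Real.exp (-ε * ‖z‖)) =O[coneAtInfinity c]
      fun z : ℂ => ‖z‖ ^ (3 / 2 : ℝ) * Real.exp (-ε * ‖z‖) := by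
    refine IsBigO.mul ?_ (isBigO_refl _ _)
    refine (symbol_isEquivalent hc).isBigO.norm_left.trans ?_
    refine IsBigO.trans (isBigO_const_mul_self _ _ _) (IsBigO.of_norm_le fun z => ?_)
    have : (3 / 2 : ℂ) = ((3 / 2 : ℝ) : ℂ) := by norm_num
    rw [this, Complex.norm_cpow_real]
  exact h1.trans_tendsto ((tendsto_rpow_mul_exp_neg_mul_atTop_nhds_zero (3 / 2) ε hε).comp
    (tendsto_norm_coneAtInfinity c))

lemma symbol_mem_symbolSpace : symbol ∈ symbolSpace symbolRadius := by
  refine ⟨?_, fun θ ε hε => ?_⟩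
  · have h : DifferentiableOn ℂ symbol rootDomain := by
      unfold symbol
      exact DifferentiableOn.mul (by fun_prop) differentiableOn_root
    exact h.mono (iUnion_subset sector_subset_rootDomain)
  · obtain ⟨R, hR⟩ := eventually_cobounded_inf_principal
      (((tendsto_symbol_mul_exp (cos_pos_of_mem θ) hε).eventually_lt_const one_pos).filter_mono
        (sector_filter_le (le_pi_of_mem θ) (symbolRadius θ)))
    -- Beyond `R` the decay gives the bound `1`; on the bounded part of the sector `|root| ≤ 1/8`
    -- gives `4 R e^R / 8`. No continuity up to the boundary is needed.
    refine ⟨max 1 (R * Real.exp R), ?_⟩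
    rintro _ ⟨z, hz, rfl⟩
    rcases lt_or_ge (R : ℝ) ‖z‖ with h | h
    · exact (hR z hz h).le.trans (le_max_left _ _)
    · refine le_trans ?_ (le_max_right _ _)
      have h1 := norm_root_le_eighth (sector_subset_rootDomain θ hz)
      have h2 : Real.exp (-ε * ‖z‖) ≤ 1 := by
        rw [Real.exp_le_one_iff]; nlinarith [norm_nonneg z]
      have h3 : ‖symbol z‖ ≤ R * Real.exp R := by
        rw [symbol, norm_mul, norm_mul, norm_mul, Complex.norm_exp]
        have h4 : z.re ≤ R := (Complex.re_le_norm z).trans h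
        calc ‖(-4 : ℂ)‖ * ‖z‖ * Real.exp z.re * ‖root z‖ ≤
            4 * R * Real.exp R * (1 / 8) := by
              gcongr
              simp
          _ ≤ _ := by
              have : 0 ≤ (R : ℝ) * Real.exp R := by positivity
              linarith
      exact (mul_le_mul h3 h2 (Real.exp_pos _).le (by positivity)).trans_eq (mul_one _)

lemma ofReal_mem_rootDomain {α : ℝ} (h : rZero symbolRadius < α) : (α : ℂ) ∈ rootDomain := by
  have : Nonempty (Ioo (0 : ℝ) (Real.pi / 2)) :=
    ⟨⟨Real.pi / 4, by linarith [Real.pi_pos], by linarith [Real.pi_pos]⟩⟩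
  obtain ⟨θ, hθ⟩ := exists_lt_of_ciInf_lt h
  have h0 : 0 < α := (NNReal.coe_nonneg _).trans_lt hθ
  refine sector_subset_rootDomain θ ⟨?_, ?_⟩
  · rwa [Complex.norm_real, Real.norm_of_nonneg h0.le]
  · rw [Complex.arg_ofReal_of_nonneg h0.le, abs_zero]
    exact θ.2.1

end GrushinSymbol

/-! ## Functions in `L²(-1, 1)` -/

namespace GrushinSymbol

lemma continuous_bounded_interval {f : ℝ → ℝ} (hf : Continuous f) :
    ∃ C, ∀ x ∈ interval, ‖f x‖ ≤ C := by
  obtain ⟨C, hC⟩ := (isCompact_Icc (a := (-1 : ℝ)) (b := 1)).exists_bound_of_continuousOn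
    hf.continuousOn
  exact ⟨C, fun x hx => hC x (Ioo_subset_Icc_self hx)⟩

instance : IsFiniteMeasure (volume.restrict interval) :=
  ⟨by rw [Measure.restrict_apply_univ, Real.volume_Ioo]; exact ENNReal.ofReal_lt_top⟩

lemma memLp_of_continuous {f : ℝ → ℝ} (hf : Continuous f) (p : ℝ≥0∞) :
    MemLp f p (volume.restrict interval) := by
  obtain ⟨C, hC⟩ := continuous_bounded_interval hf
  refine MemLp.of_bound hf.aestronglyMeasurable C ?_
  filter_upwards [ae_restrict_mem measurableSet_Ioo] with x hx using hC x hx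

lemma integrableOn_of_continuous {f : ℝ → ℝ} (hf : Continuous f) : IntegrableOn f interval :=
  memLp_one_iff_integrable.1 (memLp_of_continuous hf 1)

/-- The class in `L²(-1, 1)` of a continuous function. -/
noncomputable def toL2 (f : ℝ → ℝ) (hf : Continuous f) : L2 := (memLp_of_continuous hf 2).toLp f

lemma coeFn_toL2 {f : ℝ → ℝ} (hf : Continuous f) : toL2 f hf =ᵐ[volume.restrict interval] f :=
  MemLp.coeFn_toLp _

lemma inner_eq_integral (u v : L2) : inner ℝ u v = ∫ x in interval, u x * v x := by
  rw [L2.inner_def]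
  refine integral_congr_ae (Eventually.of_forall fun x => ?_)
  simp [mul_comm]

lemma inner_eq_integral_of_ae {u v : L2} {f g : ℝ → ℝ} (hf : u =ᵐ[volume.restrict interval] f)
    (hg : v =ᵐ[volume.restrict interval] g) : inner ℝ u v = ∫ x in interval, f x * g x := by
  rw [inner_eq_integral]
  refine integral_congr_ae ?_
  filter_upwards [hf, hg] with x h1 h2
  rw [h1, h2]

lemma tendsto_toL2 {f : ℕ → ℝ → ℝ} {g : ℝ → ℝ} (hf : ∀ n, Continuous (f n)) (hg : Continuous g)
    {C : ℝ} (hC : ∀ n, ∀ x ∈ interval, |f n x| ≤ C)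
    (hlim : ∀ x ∈ interval, Tendsto (fun n => f n x) atTop (𝓝 (g x))) :
    Tendsto (fun n => toL2 (f n) (hf n)) atTop (𝓝 (toL2 g hg)) := by
  obtain ⟨D, hD⟩ := continuous_bounded_interval hg
  rw [tendsto_iff_norm_sub_tendsto_zero]
  have hsq : ∀ n, ‖toL2 (f n) (hf n) - toL2 g hg‖ ^ 2 =
      ∫ x in interval, (f n x - g x) * (f n x - g x) := fun n => by
    have h : (toL2 (f n) (hf n) - toL2 g hg : L2) =ᵐ[volume.restrict interval]
        fun x => f n x - g x := by
      filter_upwards [Lp.coeFn_sub (toL2 (f n) (hf n)) (toL2 g hg), coeFn_toL2 (hf n),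
        coeFn_toL2 hg] with x h1 h2 h3
      rw [h1, Pi.sub_apply, h2, h3]
    rw [← real_inner_self_eq_norm_sq]
    exact inner_eq_integral_of_ae h h
  have h0 : Tendsto (fun n => ∫ x in interval, (f n x - g x) * (f n x - g x)) atTop
      (𝓝 (∫ x in interval, (0 : ℝ))) := by
    refine tendsto_integral_of_dominated_convergence (fun _ => (C + D) * (C + D))
      (fun n => ?_) (integrable_const _) (fun n => ?_) ?_
    · have := hf n
      exact Continuous.aestronglyMeasurable (by fun_prop)
    · filter_upwards [ae_restrict_mem measurableSet_Ioo] with x hx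
      have h1 : |f n x - g x| ≤ C + D := (abs_sub _ _).trans (add_le_add (hC n x hx) (hD x hx))
      rw [norm_mul, Real.norm_eq_abs]
      exact mul_le_mul h1 h1 (abs_nonneg _) ((abs_nonneg _).trans h1)
    · filter_upwards [ae_restrict_mem measurableSet_Ioo] with x hx
      have h1 := (hlim x hx).sub_const (g x)
      rw [sub_self] at h1
      simpa using h1.mul h1
  rw [integral_zero] at h0
  have h1 := h0.sqrt
  rw [Real.sqrt_zero] at h1
  refine h1.congr fun n => ?_
  rw [← hsq n, Real.sqrt_sq (norm_nonneg _)]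

/-- Multiplication by `x` on `L²(-1, 1)`. -/
noncomputable def mulX : L2 →L[ℝ] L2 :=
  (ContinuousLinearMap.mul ℝ ℝ).holderL (volume.restrict interval) ⊤ 2 2
    ((memLp_of_continuous continuous_id ⊤).toLp id)

lemma coeFn_mulX (u : L2) : mulX u =ᵐ[volume.restrict interval] fun x => x * u x := by
  have h := (ContinuousLinearMap.mul ℝ ℝ).coeFn_holder (r := 2)
    ((memLp_of_continuous continuous_id ⊤).toLp id) u
  filter_upwards [h, (memLp_of_continuous continuous_id ⊤).coeFn_toLp] with x h1 h2
  rw [mulX, ContinuousLinearMap.holderL_apply_apply, h1, h2]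
  rfl

/-! ## Test functions -/

lemma IsTestFunction.continuous_deriv {φ : ℝ → ℝ} (h : IsTestFunction φ) :
    Continuous (deriv φ) :=
  h.contDiff.continuous_deriv (by norm_num)

lemma IsTestFunction.differentiable {φ : ℝ → ℝ} (h : IsTestFunction φ) : Differentiable ℝ φ :=
  h.contDiff.differentiable (by norm_num)

lemma IsTestFunction.deriv {φ : ℝ → ℝ} (h : IsTestFunction φ) : IsTestFunction (deriv φ) where
  contDiff := (contDiff_infty_iff_deriv.1 h.contDiff).2
  hasCompactSupport := h.hasCompactSupport.deriv
  tsupport_subset := (tsupport_deriv_subset (f := φ)).trans h.tsupport_subset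

lemma IsTestFunction.eq_zero {φ : ℝ → ℝ} (h : IsTestFunction φ) {x : ℝ} (hx : x ∉ interval) :
    φ x = 0 :=
  image_eq_zero_of_notMem_tsupport fun hm => hx (h.tsupport_subset hm)

lemma setIntegral_deriv_eq_zero {W : ℝ → ℝ} (hW : ContDiff ℝ 1 W) (h1 : W 1 = 0)
    (h2 : W (-1) = 0) : ∫ x in interval, deriv W x = 0 := by
  rw [← integral_Ioc_eq_integral_Ioo, ← intervalIntegral.integral_of_le (by norm_num),
    intervalIntegral.integral_deriv_eq_sub (fun x _ => hW.differentiable (by norm_num) x)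
      ((hW.continuous_deriv le_rfl).intervalIntegrable _ _), h1, h2, sub_zero]

lemma setIntegral_mul_deriv_test {f φ : ℝ → ℝ} (hf : ContDiff ℝ 1 f) (hφ : IsTestFunction φ) :
    ∫ x in interval, f x * deriv φ x = -∫ x in interval, deriv f x * φ x := by
  have hW : ContDiff ℝ 1 fun x => f x * φ x := hf.mul (hφ.contDiff.of_le (by norm_num))
  have h := setIntegral_deriv_eq_zero hW (by rw [hφ.eq_zero (by simp), mul_zero])
    (by rw [hφ.eq_zero (by simp), mul_zero])
  have hd : ∀ x, deriv (fun x => f x * φ x) x = deriv f x * φ x + f x * deriv φ x := fun x =>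
    deriv_fun_mul (hf.differentiable (by norm_num) x) (hφ.differentiable x)
  have c1 : Continuous (deriv f) := hf.continuous_deriv le_rfl
  have c2 := hφ.continuous_deriv
  have c3 := hφ.contDiff.continuous
  have c4 := hf.continuous
  simp_rw [hd] at h
  rw [integral_add (integrableOn_of_continuous (by fun_prop))
    (integrableOn_of_continuous (by fun_prop))] at h
  linarith

lemma hasWeakDeriv_toL2 {f : ℝ → ℝ} (hf : ContDiff ℝ 1 f) :
    HasWeakDeriv (toL2 f hf.continuous) (toL2 (deriv f) (hf.continuous_deriv le_rfl)) := by
  intro φ hφ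
  have h := setIntegral_mul_deriv_test hf hφ
  have e1 : ∫ x in interval, toL2 f hf.continuous x * deriv φ x =
      ∫ x in interval, f x * deriv φ x := by
    refine integral_congr_ae ?_
    filter_upwards [coeFn_toL2 hf.continuous] with x hx
    rw [hx]
  have e2 : ∫ x in interval, toL2 (deriv f) (hf.continuous_deriv le_rfl) x * φ x =
      ∫ x in interval, deriv f x * φ x := by
    refine integral_congr_ae ?_
    filter_upwards [coeFn_toL2 (hf.continuous_deriv le_rfl)] with x hx
    rw [hx]
  rw [e1, e2, h]

lemma HasWeakDeriv.inner_eq {u v : L2} (h : HasWeakDeriv u v) {p : L2 × L2}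
    (hp : p ∈ testGraph) : inner ℝ u p.2 = -inner ℝ v p.1 := by
  obtain ⟨φ, hφ, h1, h2⟩ := hp
  rw [inner_eq_integral_of_ae (EventuallyEq.refl _ _) h2,
    inner_eq_integral_of_ae (EventuallyEq.refl _ _) h1]
  exact h φ hφ

lemma inner_testGraph {p q : L2 × L2} (hp : p ∈ testGraph) (hq : q ∈ testGraph) :
    inner ℝ p.1 q.2 = -inner ℝ p.2 q.1 := by
  obtain ⟨φ, hφ, h1, h2⟩ := hp
  obtain ⟨ψ, hψ, h3, h4⟩ := hq
  rw [inner_eq_integral_of_ae h1 h4, inner_eq_integral_of_ae h2 h3]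
  exact setIntegral_mul_deriv_test (hφ.contDiff.of_le (by norm_num)) hψ

/-- A weak derivative of an element of `H¹₀` pairs like its strong derivative with the latter. -/
lemma inner_weakDeriv_eq_norm_sq {u v w : L2} (hv : (u, v) ∈ closure testGraph)
    (hw : HasWeakDeriv u w) : inner ℝ w v = ‖v‖ ^ 2 := by
  have h1 : ∀ q ∈ testGraph, inner ℝ u q.2 = -inner ℝ v q.1 := fun q hq => by
    have hc : IsClosed {p : L2 × L2 | inner ℝ p.1 q.2 = -inner ℝ p.2 q.1} :=
      isClosed_eq (by fun_prop) (by fun_prop)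
    exact hc.closure_subset_iff.2 (fun p hp => inner_testGraph hp hq) hv
  -- The derivative of a test function is again a test function, so `w` and `v` may both be tested
  -- against it. Since `v` is a limit of such derivatives, this suffices, and the equality `w = v`
  -- is never needed.
  have h2 : ∀ q ∈ testGraph, inner ℝ w q.2 = inner ℝ v q.2 := fun q hq => by
    obtain ⟨φ, hφ, h3, h4⟩ := hq
    have hq' : (q.2, toL2 (deriv (deriv φ)) hφ.deriv.continuous_deriv) ∈ testGraph :=
      ⟨deriv φ, hφ.deriv, h4, coeFn_toL2 hφ.deriv.continuous_deriv⟩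
    have h5 := h1 _ hq'
    have h6 := hw.inner_eq hq'
    simp only at h5 h6
    linarith
  have hc : IsClosed {p : L2 × L2 | inner ℝ w p.2 = inner ℝ v p.2} :=
    isClosed_eq (by fun_prop) (by fun_prop)
  have h3 : inner ℝ w v = inner ℝ v v := hc.closure_subset_iff.2 h2 hv
  rw [h3, real_inner_self_eq_norm_sq]

/-! ## A positive solution is the ground state -/

/-- The quadratic form of `P_α - lam`, as a function of `u` and `u'`. -/
noncomputable def energy (α lam : ℝ) (p : L2 × L2) : ℝ :=
  ‖p.2‖ ^ 2 + α ^ 2 * ‖mulX p.1‖ ^ 2 - lam * ‖p.1‖ ^ 2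

lemma continuous_energy (α lam : ℝ) : Continuous (energy α lam) := by
  have h1 : Continuous fun p : L2 × L2 => mulX p.1 := mulX.continuous.comp continuous_fst
  exact ((continuous_snd.norm.pow 2).add (continuous_const.mul (h1.norm.pow 2))).sub
    (continuous_const.mul (continuous_fst.norm.pow 2))

/-- A smooth solution of `-ψ'' + (α x)² ψ = lam ψ` which is positive exactly on `(-1, 1)`. -/
structure IsGroundState (α lam : ℝ) (ψ : ℝ → ℝ) : Prop where
  contDiff : ContDiff ℝ ∞ ψ
  pos : ∀ x ∈ interval, 0 < ψ x
  nonpos : ∀ x, x ∉ interval → ψ x ≤ 0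
  ode : ∀ x, deriv (deriv ψ) x = ((α * x) ^ 2 - lam) * ψ x

namespace IsGroundState

variable {α lam : ℝ} {ψ : ℝ → ℝ}

lemma contDiff_deriv (h : IsGroundState α lam ψ) : ContDiff ℝ ∞ (deriv ψ) :=
  (contDiff_infty_iff_deriv.1 h.contDiff).2

/-- Jacobi's inequality for test functions. -/
lemma integral_nonneg (h : IsGroundState α lam ψ) {φ : ℝ → ℝ} (hφ : IsTestFunction φ) :
    0 ≤ ∫ x in interval, (deriv φ x ^ 2 + ((α * x) ^ 2 - lam) * φ x ^ 2) := by
  -- The integrand minus `W'` is the square `(φ' - (ψ'/ψ) φ)²`, and `W'` integrates to zero. The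
  -- factor `φ²` makes `W` vanish near the zeros of `ψ`.
  set W : ℝ → ℝ := fun x => deriv ψ x / ψ x * φ x ^ 2 with hW
  have hWc : ContDiff ℝ 1 W := by
    rw [contDiff_iff_contDiffAt]
    intro x
    by_cases hx : x ∈ tsupport φ
    · have h1 : ContDiffAt ℝ 1 (deriv ψ) x := (h.contDiff_deriv.of_le (by norm_num)).contDiffAt
      have h2 : ContDiffAt ℝ 1 ψ x := (h.contDiff.of_le (by norm_num)).contDiffAt
      have h3 : ContDiffAt ℝ 1 φ x := (hφ.contDiff.of_le (by norm_num)).contDiffAt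
      exact (h1.div h2 (h.pos x (hφ.tsupport_subset hx)).ne').mul (h3.pow 2)
    · have h0 : W =ᶠ[𝓝 x] fun _ => 0 := by
        filter_upwards [notMem_tsupport_iff_eventuallyEq.1 hx] with y hy
        simp [hW, hy]
      exact contDiffAt_const.congr_of_eventuallyEq h0
  have hWz : ∀ x, x ∉ interval → W x = 0 := fun x hx => by simp [hW, hφ.eq_zero hx]
  rw [← setIntegral_deriv_eq_zero hWc (hWz 1 (by simp)) (hWz (-1) (by simp))]
  have c1 : Continuous (deriv W) := hWc.continuous_deriv le_rfl
  have c2 := hφ.continuous_deriv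
  have c3 := hφ.contDiff.continuous
  refine setIntegral_mono_on (integrableOn_of_continuous c1)
    (integrableOn_of_continuous (by fun_prop)) measurableSet_Ioo fun x hx => ?_
  have hp := h.pos x hx
  have d1 : HasDerivAt (deriv ψ) (((α * x) ^ 2 - lam) * ψ x) x := by
    rw [← h.ode x]
    exact (h.contDiff_deriv.differentiable (by norm_num) x).hasDerivAt
  have d2 : HasDerivAt ψ (deriv ψ x) x := (h.contDiff.differentiable (by norm_num) x).hasDerivAt
  have d3 := (d1.div d2 hp.ne').mul ((hφ.differentiable x).hasDerivAt.pow 2)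
  have d4 : deriv W x = _ := d3.deriv
  rw [d4]
  have e : deriv φ x ^ 2 + ((α * x) ^ 2 - lam) * φ x ^ 2 -
      ((((α * x) ^ 2 - lam) * ψ x * ψ x - deriv ψ x * deriv ψ x) / ψ x ^ 2 * φ x ^ 2 +
        deriv ψ x / ψ x * (2 * φ x * deriv φ x)) = (deriv φ x - deriv ψ x / ψ x * φ x) ^ 2 := by
    field_simp
    ring
  have := sq_nonneg (deriv φ x - deriv ψ x / ψ x * φ x)
  rw [← e] at this
  simp only [Pi.div_apply, Pi.pow_apply, Nat.cast_ofNat, Nat.add_one_sub_one, pow_one]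
  linarith

lemma form_nonneg_of_mem_testGraph (h : IsGroundState α lam ψ) {p : L2 × L2}
    (hp : p ∈ testGraph) : 0 ≤ energy α lam p := by
  obtain ⟨φ, hφ, h1, h2⟩ := hp
  have h3 : mulX p.1 =ᵐ[volume.restrict interval] fun x => x * φ x := by
    filter_upwards [coeFn_mulX p.1, h1] with x h4 h5
    rw [h4, h5]
  have c2 := hφ.continuous_deriv
  have c3 := hφ.contDiff.continuous
  rw [energy, ← real_inner_self_eq_norm_sq, ← real_inner_self_eq_norm_sq, ← real_inner_self_eq_norm_sq,
    inner_eq_integral_of_ae h1 h1, inner_eq_integral_of_ae h2 h2, inner_eq_integral_of_ae h3 h3,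
    ← integral_const_mul, ← integral_const_mul,
    ← integral_add (integrableOn_of_continuous (by fun_prop))
      (integrableOn_of_continuous (by fun_prop)),
    ← integral_sub (integrableOn_of_continuous (by fun_prop))
      (integrableOn_of_continuous (by fun_prop))]
  refine (h.integral_nonneg hφ).trans_eq (integral_congr_ae (Eventually.of_forall fun x => ?_))
  ring

lemma form_nonneg (h : IsGroundState α lam ψ) {p : L2 × L2} (hp : p ∈ closure testGraph) :
    0 ≤ energy α lam p := by
  have hsub : closure testGraph ⊆ {p | 0 ≤ energy α lam p} :=
    closure_minimal (fun p hp => h.form_nonneg_of_mem_testGraph hp)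
      (isClosed_le continuous_const (continuous_energy α lam))
  exact hsub hp

/-- Testing the eigenvalue equation for `u` against `u` itself shows that the energy equals `(μ -
lam)‖u‖²`, which is nonnegative. -/
lemma le_of_mem_eigenvalues (h : IsGroundState α lam ψ) {μ : ℝ} (hμ : μ ∈ eigenvalues α) :
    lam ≤ μ := by
  obtain ⟨u, hu0, ⟨v, hv⟩, u', u'', h1, h2, h3⟩ := hμ
  -- The weak form of the equation; it is closed in `p`, so it extends to the pair `(u, v)`.
  have h4 : ∀ p ∈ testGraph, inner ℝ u' p.2 =
      μ * inner ℝ u p.1 - α ^ 2 * inner ℝ (mulX u) (mulX p.1) := fun p hp => by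
    rw [h2.inner_eq hp, inner_eq_integral, inner_eq_integral, inner_eq_integral,
      ← integral_const_mul, ← integral_const_mul, ← integral_neg]
    have i1 : ∀ f g : L2, Integrable (fun x => f x * g x) (volume.restrict interval) :=
      fun f g => (Lp.memLp f).integrable_mul (Lp.memLp g)
    rw [← integral_sub ((i1 _ _).const_mul _) ((i1 _ _).const_mul _)]
    refine integral_congr_ae ?_
    filter_upwards [h3, Lp.coeFn_smul μ u, coeFn_mulX u, coeFn_mulX p.1] with x e1 e2 e3 e4
    rw [e2, Pi.smul_apply, smul_eq_mul] at e1
    rw [e3, e4]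
    linear_combination -(p.1 x) * e1
  have hc : IsClosed {p : L2 × L2 | inner ℝ u' p.2 =
      μ * inner ℝ u p.1 - α ^ 2 * inner ℝ (mulX u) (mulX p.1)} :=
    isClosed_eq (by fun_prop) (by fun_prop)
  have h5 : inner ℝ u' v = μ * inner ℝ u u - α ^ 2 * inner ℝ (mulX u) (mulX u) :=
    hc.closure_subset_iff.2 h4 hv
  rw [inner_weakDeriv_eq_norm_sq hv h1, real_inner_self_eq_norm_sq,
    real_inner_self_eq_norm_sq] at h5
  have h6 := h.form_nonneg hv
  simp only [energy] at h6
  have h7 : 0 < ‖u‖ ^ 2 := by have := norm_pos_iff.2 hu0; positivity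
  by_contra hlt
  push Not at hlt
  nlinarith

end IsGroundState

/-! ## The ground state lies in `H¹₀` -/

/-- A smooth truncation: `0` for `s ≤ 1` and `s` for `s ≥ 2`. -/
noncomputable def truncation (s : ℝ) : ℝ := s * Real.smoothTransition (s - 1)

lemma contDiff_truncation : ContDiff ℝ ∞ truncation :=
  contDiff_id.mul (Real.smoothTransition.contDiff.comp (contDiff_id.sub contDiff_const))

lemma truncation_eq_zero {s : ℝ} (hs : s ≤ 1) : truncation s = 0 := by
  rw [truncation, Real.smoothTransition.zero_of_nonpos (by linarith), mul_zero]

lemma truncation_eq_self {s : ℝ} (hs : 2 ≤ s) : truncation s = s := by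
  rw [truncation, Real.smoothTransition.one_of_one_le (by linarith), mul_one]

lemma abs_truncation_le (s : ℝ) : |truncation s| ≤ |s| := by
  rw [truncation, abs_mul, abs_of_nonneg (Real.smoothTransition.nonneg _)]
  exact mul_le_of_le_one_right (abs_nonneg _) (Real.smoothTransition.le_one _)

lemma deriv_truncation_eq_one {s : ℝ} (hs : 2 < s) : deriv truncation s = 1 := by
  have : truncation =ᶠ[𝓝 s] id := by
    filter_upwards [Ioi_mem_nhds hs] with t ht using truncation_eq_self (le_of_lt ht)
  rw [this.deriv_eq, deriv_id]

lemma deriv_truncation_eq_zero {s : ℝ} (hs : s < 1) : deriv truncation s = 0 := by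
  have : truncation =ᶠ[𝓝 s] fun _ => 0 := by
    filter_upwards [Iio_mem_nhds hs] with t ht using truncation_eq_zero (le_of_lt ht)
  rw [this.deriv_eq, deriv_const]

lemma continuous_deriv_truncation : Continuous (deriv truncation) :=
  contDiff_truncation.continuous_deriv (by norm_num)

lemma exists_abs_deriv_truncation_le : ∃ C, ∀ s, |deriv truncation s| ≤ C := by
  obtain ⟨C, hC⟩ := (isCompact_Icc (a := (1 : ℝ)) (b := 2)).exists_bound_of_continuousOn
    continuous_deriv_truncation.continuousOn
  refine ⟨max C 1, fun s => ?_⟩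
  rcases lt_or_ge s 1 with h1 | h1
  · rw [deriv_truncation_eq_zero h1, abs_zero]
    exact zero_le_one.trans (le_max_right _ _)
  rcases lt_or_ge 2 s with h2 | h2
  · rw [deriv_truncation_eq_one h2, abs_one]
    exact le_max_right _ _
  · exact (hC s ⟨h1, h2⟩).trans (le_max_left _ _)

namespace IsGroundState

variable {α lam : ℝ} {ψ : ℝ → ℝ}

/-- The truncation vanishes where `(n + 1)ψ ≤ 1`, hence near `±1` and outside, where `ψ ≤ 0`. This
is what the sign condition off the interval is for. -/
lemma isTestFunction_truncation (h : IsGroundState α lam ψ) (n : ℕ) :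
    IsTestFunction fun x => truncation ((n + 1) * ψ x) / (n + 1) := by
  have hsub : tsupport (fun x => truncation ((n + 1) * ψ x) / (n + 1)) ⊆
      {x | 1 ≤ (n + 1) * ψ x} := by
    refine closure_minimal (fun x hx => ?_)
      (isClosed_le continuous_const (continuous_const.mul h.contDiff.continuous))
    by_contra hlt
    rw [mem_ofPred_eq, not_le] at hlt
    exact hx (by simp only; rw [truncation_eq_zero hlt.le, zero_div])
  have hsub2 : tsupport (fun x => truncation ((n + 1) * ψ x) / (n + 1)) ⊆ interval := by
    refine hsub.trans fun x hx => ?_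
    by_contra hni
    have h1 := h.nonpos x hni
    have h2 : (1 : ℝ) ≤ (n + 1) * ψ x := hx
    have h3 : (0 : ℝ) < n + 1 := by positivity
    nlinarith
  refine ⟨(contDiff_truncation.comp (contDiff_const.mul h.contDiff)).div_const _, ?_, hsub2⟩
  exact HasCompactSupport.of_support_subset_isCompact isCompact_Icc
    ((subset_tsupport _).trans (hsub2.trans Ioo_subset_Icc_self))

lemma deriv_truncation_comp (h : IsGroundState α lam ψ) (n : ℕ) (x : ℝ) :
    deriv (fun x => truncation ((n + 1) * ψ x) / (n + 1)) x =
      deriv truncation ((n + 1) * ψ x) * deriv ψ x := by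
  have d1 : HasDerivAt ψ (deriv ψ x) x := (h.contDiff.differentiable (by norm_num) x).hasDerivAt
  have d2 : HasDerivAt truncation (deriv truncation ((n + 1) * ψ x)) ((n + 1) * ψ x) :=
    (contDiff_truncation.differentiable (by norm_num) _).hasDerivAt
  have d3 := ((d2.comp x (d1.const_mul ((n : ℝ) + 1))).div_const ((n : ℝ) + 1)).deriv
  have h3 : (n : ℝ) + 1 ≠ 0 := by positivity
  refine Eq.trans d3 ?_
  field_simp

/-- At each point of the interval the truncations and their derivatives eventually agree with `ψ`
and `ψ'`. Uniform bounds then give convergence in `L²` by dominated convergence. -/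
lemma mem_closure_testGraph (h : IsGroundState α lam ψ) :
    (toL2 ψ h.contDiff.continuous, toL2 (deriv ψ) h.contDiff_deriv.continuous) ∈
      closure testGraph := by
  obtain ⟨C, hC⟩ := exists_abs_deriv_truncation_le
  obtain ⟨D, hD⟩ := continuous_bounded_interval h.contDiff.continuous
  obtain ⟨E, hE⟩ := continuous_bounded_interval h.contDiff_deriv.continuous
  have hev : ∀ x ∈ interval, ∀ᶠ n : ℕ in atTop, 2 < ((n : ℝ) + 1) * ψ x := fun x hx =>
    ((tendsto_atTop_add_const_right _ 1 tendsto_natCast_atTop_atTop).atTop_mul_const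
      (h.pos x hx)).eventually_gt_atTop 2
  have t1 := tendsto_toL2 (f := fun n x => truncation ((n + 1) * ψ x) / (n + 1)) (g := ψ)
    (fun n => (h.isTestFunction_truncation n).contDiff.continuous) h.contDiff.continuous (C := D)
    (fun n x hx => by
      have h3 : (0 : ℝ) < n + 1 := by positivity
      rw [abs_div, abs_of_pos h3, div_le_iff₀ h3]
      refine (abs_truncation_le _).trans ?_
      rw [abs_mul, abs_of_pos h3, mul_comm]
      gcongr
      exact hD x hx)
    (fun x hx => by
      refine tendsto_const_nhds.congr' ?_
      filter_upwards [hev x hx] with n hn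
      have h3 : (n : ℝ) + 1 ≠ 0 := by positivity
      rw [truncation_eq_self hn.le]
      field_simp)
  have t2 := tendsto_toL2 (f := fun n => deriv fun x => truncation ((n + 1) * ψ x) / (n + 1))
    (g := deriv ψ) (fun n => (h.isTestFunction_truncation n).continuous_deriv)
    h.contDiff_deriv.continuous (C := C * E)
    (fun n x hx => by
      rw [h.deriv_truncation_comp, abs_mul]
      exact mul_le_mul (hC _) (hE x hx) (abs_nonneg _) ((abs_nonneg _).trans (hC 0)))
    (fun x hx => by
      refine tendsto_const_nhds.congr' ?_
      filter_upwards [hev x hx] with n hn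
      rw [h.deriv_truncation_comp, deriv_truncation_eq_one hn, one_mul])
  refine mem_closure_of_tendsto (t1.prodMk_nhds t2) (Eventually.of_forall fun n => ?_)
  have hn := h.isTestFunction_truncation n
  exact ⟨_, hn, coeFn_toL2 hn.contDiff.continuous, coeFn_toL2 hn.continuous_deriv⟩

lemma toL2_ne_zero (h : IsGroundState α lam ψ) : toL2 ψ h.contDiff.continuous ≠ 0 := by
  intro h0
  have h1 : ∀ᵐ x ∂volume.restrict interval, False := by
    filter_upwards [coeFn_toL2 h.contDiff.continuous, Lp.coeFn_zero ℝ 2 (volume.restrict interval),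
      ae_restrict_mem measurableSet_Ioo] with x e1 e2 hx
    rw [h0, e2] at e1
    exact (h.pos x hx).ne e1
  rw [eventually_false_iff_eq_bot, ae_eq_bot, Measure.restrict_eq_zero, Real.volume_Ioo] at h1
  norm_num at h1

lemma mem_eigenvalues (h : IsGroundState α lam ψ) : lam ∈ eigenvalues α := by
  have c1 : ContDiff ℝ 1 ψ := h.contDiff.of_le (by norm_num)
  have c2 : ContDiff ℝ 1 (deriv ψ) := h.contDiff_deriv.of_le (by norm_num)
  refine ⟨toL2 ψ h.contDiff.continuous, h.toL2_ne_zero, ⟨_, h.mem_closure_testGraph⟩,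
    _, _, hasWeakDeriv_toL2 c1, hasWeakDeriv_toL2 c2, ?_⟩
  filter_upwards [Lp.coeFn_smul lam (toL2 ψ h.contDiff.continuous),
    coeFn_toL2 h.contDiff.continuous, coeFn_toL2 (c2.continuous_deriv le_rfl)] with x e1 e2 e3
  rw [e1, Pi.smul_apply, e2, e3, h.ode x, smul_eq_mul]
  ring

lemma isFirstEigenvalue (h : IsGroundState α lam ψ) : IsFirstEigenvalue α lam :=
  ⟨h.mem_eigenvalues, fun _ hμ => h.le_of_mem_eigenvalues hμ⟩

end IsGroundState

end GrushinSymbol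

/-! ## The ground state in terms of Kummer's function -/

namespace GrushinSymbol

/-- The solution `e ^ (-α w² / 2) M(a, 1/2, α w²)` of `-V'' + (α w)² V = (α - 4 α a) V`. -/
noncomputable def kummerSolution (a α w : ℂ) : ℂ :=
  Complex.exp (-(α * w ^ 2 / 2)) * (1 + a * kummer a (α * w ^ 2))

/-- The derivative of `kummerSolution`. -/
noncomputable def kummerSolutionDeriv (a α w : ℂ) : ℂ :=
  Complex.exp (-(α * w ^ 2 / 2)) *
    (-(α * w) * (1 + a * kummer a (α * w ^ 2)) +
      2 * α * a * (w * deriv (kummer a) (α * w ^ 2)))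

lemma hasDerivAt_gaussian (α w : ℂ) :
    HasDerivAt (fun w : ℂ => Complex.exp (-(α * w ^ 2 / 2)))
      (Complex.exp (-(α * w ^ 2 / 2)) * -(α * w)) w := by
  have h : HasDerivAt (fun w : ℂ => -(α * w ^ 2 / 2)) (-(α * w)) w :=
    (((hasDerivAt_pow 2 w).const_mul α).div_const 2).neg.congr_deriv (by push_cast; ring)
  exact h.cexp

lemma hasDerivAt_comp_mul_sq {f : ℂ → ℂ} (hf : Differentiable ℂ f) (α w : ℂ) :
    HasDerivAt (fun w => f (α * w ^ 2)) (deriv f (α * w ^ 2) * (2 * α * w)) w := by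
  have h : HasDerivAt (fun w : ℂ => α * w ^ 2) (2 * α * w) w :=
    ((hasDerivAt_pow 2 w).const_mul α).congr_deriv (by push_cast; ring)
  exact (hf _).hasDerivAt.comp w h

lemma hasDerivAt_kummerSolution {a : ℂ} (ha : ‖a‖ ≤ 1) (α w : ℂ) :
    HasDerivAt (kummerSolution a α) (kummerSolutionDeriv a α w) w := by
  have h := (hasDerivAt_gaussian α w).mul
    (((hasDerivAt_comp_mul_sq (differentiable_kummer ha) α w).const_mul a).const_add 1)
  refine h.congr_deriv ?_
  rw [kummerSolutionDeriv]
  ring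

lemma hasDerivAt_kummerSolutionDeriv {a : ℂ} (ha : ‖a‖ ≤ 1) (α w : ℂ) :
    HasDerivAt (kummerSolutionDeriv a α)
      (((α * w) ^ 2 - (α - 4 * α * a)) * kummerSolution a α w) w := by
  have hd : Differentiable ℂ (deriv (kummer a)) := by
    rw [← differentiableOn_univ]
    exact (differentiable_kummer ha).differentiableOn.deriv isOpen_univ
  have h1 := ((hasDerivAt_comp_mul_sq (differentiable_kummer ha) α w).const_mul a).const_add 1
  have h2 := hasDerivAt_comp_mul_sq hd α w
  have h3 : HasDerivAt (fun w : ℂ => -(α * w)) (-α) w :=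
    ((hasDerivAt_id w).const_mul α).neg.congr_deriv (by ring)
  have h := (hasDerivAt_gaussian α w).mul
    ((h3.mul h1).add (((hasDerivAt_id w).mul h2).const_mul (2 * α * a)))
  refine h.congr_deriv ?_
  have ode := kummer_ode ha (α * w ^ 2)
  rw [kummerSolution]
  simp only [Pi.mul_apply, Pi.add_apply, id]
  -- Kummer's equation at `αw²` accounts for the whole second derivative; the factor `4αa` is the
  -- shift of the eigenvalue away from `α`.
  linear_combination (4 * α * a * Complex.exp (-(α * w ^ 2 / 2))) * ode

lemma differentiable_kummerSolution {a : ℂ} (ha : ‖a‖ ≤ 1) (α : ℂ) :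
    Differentiable ℂ (kummerSolution a α) :=
  fun w => (hasDerivAt_kummerSolution ha α w).differentiableAt

lemma kummerSolution_ofReal_re (a α x : ℝ) :
    (kummerSolution a α x).re =
      Real.exp (-(α * x ^ 2 / 2)) * (1 + a * (kummer a ((α * x ^ 2 : ℝ) : ℂ)).re) := by
  have h : kummerSolution a α x =
      ((Real.exp (-(α * x ^ 2 / 2)) * (1 + a * (kummer a ((α * x ^ 2 : ℝ) : ℂ)).re) : ℝ) : ℂ) := by
    have hk := kummer_ofReal (a := a) (α * x ^ 2)
    rw [Complex.ofReal_mul _ (1 + _), Complex.ofReal_add, Complex.ofReal_mul a, ← hk,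
      kummerSolution]
    push_cast
    rfl
  rw [h, Complex.ofReal_re]

/-- Since `kummer a α > 0`, the boundary condition forces `a < 0`. Then `1 + a * kummer a (αx²)`
decreases strictly in `x²` and is zero at `x² = 1`, which gives both sign conditions. -/
lemma isGroundState_kummerSolution {a α : ℝ} (hα : 0 < α) (ha : |a| < 1)
    (h : 1 + a * (kummer a α).re = 0) :
    IsGroundState α (α - 4 * α * a) fun x => (kummerSolution a α x).re := by
  obtain ⟨ha1, ha2⟩ := abs_lt.1 ha
  have hn : ‖(a : ℂ)‖ ≤ 1 := by rw [Complex.norm_real]; exact ha.le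
  have hpos : 0 < (kummer a α).re := by
    have := kummer_re_lt ha1 ha2.le le_rfl hα
    rwa [Complex.ofReal_zero, kummer_zero_right, Complex.zero_re] at this
  have ha0 : a < 0 := by
    by_contra hge
    push Not at hge
    nlinarith
  have hd : deriv (fun x : ℝ => (kummerSolution a α x).re) =
      fun x : ℝ => (kummerSolutionDeriv a α x).re :=
    funext fun x => (hasDerivAt_kummerSolution hn α x).real_of_complex.deriv
  refine ⟨(differentiable_kummerSolution hn α).contDiff.real_of_complex, fun x hx => ?_,
    fun x hx => ?_, fun x => ?_⟩
  · rw [kummerSolution_ofReal_re]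
    have hx2 : α * x ^ 2 < α := by
      have : x ^ 2 < 1 := by nlinarith [hx.1, hx.2]
      nlinarith
    have := kummer_re_lt ha1 ha2.le (by positivity) hx2
    have h2 : 0 < 1 + a * (kummer a ((α * x ^ 2 : ℝ) : ℂ)).re := by nlinarith
    positivity
  · rw [kummerSolution_ofReal_re]
    refine mul_nonpos_of_nonneg_of_nonpos (Real.exp_pos _).le ?_
    have hx2 : α ≤ α * x ^ 2 := by
      have : 1 ≤ x ^ 2 := by
        rw [one_le_sq_iff_one_le_abs]
        by_contra hlt
        exact hx (abs_lt.1 (not_le.1 hlt))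
      nlinarith
    rcases hx2.eq_or_lt with he | hlt
    · rw [← he, h]
    · have := kummer_re_lt ha1 ha2.le hα.le hlt
      nlinarith
  · rw [hd, (hasDerivAt_kummerSolutionDeriv hn α x).real_of_complex.deriv]
    have : ((α : ℂ) * x) ^ 2 - (α - 4 * α * a) = (((α * x) ^ 2 - (α - 4 * α * a) : ℝ) : ℂ) := by
      push_cast; ring
    rw [this, Complex.re_ofReal_mul]

lemma isFirstEigenvalue_of_mem_rootDomain {α : ℝ} (h : (α : ℂ) ∈ rootDomain) :
    IsFirstEigenvalue α (α - 4 * α * (root α).re) := by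
  have hα : 0 < α := h.1
  have hr := root_ofReal h
  have hn := norm_root_le_eighth h
  have h1 := one_add_root_mul_kummer h
  rw [hr] at hn h1
  rw [Complex.norm_real, Real.norm_eq_abs] at hn
  refine (isGroundState_kummerSolution hα (hn.trans_lt (by norm_num)) ?_).isFirstEigenvalue
  have h2 := congrArg Complex.re h1
  rwa [Complex.add_re, Complex.re_ofReal_mul, Complex.one_re, Complex.zero_re] at h2

end GrushinSymbol

theorem mainTheorem3 :
    ∃ r : Set.Ioo (0 : ℝ) (Real.pi / 2) → ℝ≥0, Monotone r ∧
      ∃ γ ∈ GrushinSymbol.symbolSpace r,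
        (∀ α : ℝ, GrushinSymbol.rZero r < α →
          ∃ μ : ℝ, GrushinSymbol.IsFirstEigenvalue α μ ∧
            (μ : ℂ) = (α : ℂ) + γ (α : ℂ) * Complex.exp (-(α : ℂ))) ∧
        ∀ θ : Set.Ioo (0 : ℝ) (Real.pi / 2),
          Asymptotics.IsEquivalent
            (Bornology.cobounded ℂ ⊓ Filter.principal (GrushinSymbol.sector θ (r θ)))
            γ (fun α : ℂ =>
              4 * ((Real.pi ^ (-(1 / 2 : ℝ)) : ℝ) : ℂ) * α ^ (3 / 2 : ℂ)) := by
  open GrushinSymbol in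
  refine ⟨symbolRadius, monotone_symbolRadius, symbol, symbol_mem_symbolSpace, fun α hα => ?_,
    fun θ => (symbol_isEquivalent (cos_pos_of_mem θ)).mono
      (sector_filter_le (le_pi_of_mem θ) _)⟩
  have h := ofReal_mem_rootDomain hα
  refine ⟨_, isFirstEigenvalue_of_mem_rootDomain h, ?_⟩
  have hr := root_ofReal h
  have he : Complex.exp (α : ℂ) * Complex.exp (-(α : ℂ)) = 1 := by
    rw [← Complex.exp_add, add_neg_cancel, Complex.exp_zero]
  rw [symbol]
  push_cast
  rw [← hr]
  linear_combination (4 * (α : ℂ) * root α) * he
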